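/- Let $S$ be a finite inverse semigroup. Write $\operatorname{dom} s=ss^{-1}$, $\operatorname{ran} s=s^{-1}s$, $E(S)$ for the set of idempotents, $s\le t$ iff $s=et$ for some $e\in E(S)$, and for $e\in E(S)$ let $G_e=\{s\in S:\operatorname{dom}s=e=\operatorname{ran}s\}$ be the maximal subgroup at $e$. Idempotents $e,f$ are isomorphic if $e=\operatorname{dom}s$, $f=\operatorname{ran}s$ for some $s\in S$; write $e\preceq f$ if $e$ is isomorphic to some $e'\le f$. Elements $g\in G_e$, $h\in G_f$ are conjugate in $S$ if $g=shs^{-1}$ for some $s$ with $\operatorname{dom}s=e$, $\operatorname{ran}s=f$. Let $e_1,\dots,e_n$ represent the isomorphism classes of idempotents, each exactly once, numbered so that $e_i\preceq e_j$ implies $i\le j$; put $G_i=G_{e_i}$. All characters are characters of finite-dimensional complex representations. For $\chi\in\mathrm{Irr}(G_i)$ afforded by $\varphi:G_i\to GL(V)$, let $\chi^*$ be the character of the induced representation $\varphi^*$ of $S$: choose $p_f\in S$ with $\operatorname{dom}p_f=e_i$, $\operatorname{ran}p_f=f$ for each idempotent $f$ isomorphic to $e_i$; then $\varphi^*(s)$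 is the block matrix $\sum_t \varphi\big(p_{\operatorname{dom}t}\,t\,p_{\operatorname{ran}t}^{-1}\big)E_{\operatorname{dom}t,\operatorname{ran}t}$, the sum over all $t\le s$ with $\operatorname{dom}t$ isomorphic to $e_i$. For functions $\psi,\alpha:G\to\mathbb C$ on a finite group put $(\psi,\alpha)_G=\frac1{|G|}\sum_{g\in G}\psi(g^{-1})\alpha(g)$, and for $\chi\in \mathrm{Irr}(G_i)$ and a character $\theta$ of $S$ put $$(\chi,\theta)_S=\sum_{f\in E(S),\,f\le e_i}(\chi,\theta_f)_{G_i}\,\mu(f,e_i),\qquad \theta_f(s)=\theta(fs),$$ with $\mu$ the Möbius function of $(E(S),\leq)$. Let $\mathsf C$ be the matrix with rows indexed by $\biguplus_i\mathrm{Irr}(G_i)$ and columns indexed by the conjugacy classes of all the $G_j$, where $\mathsf C_{\chi,C}$ is the value of $\chi^*$ on $C$ (the character table of $S$). Let $\mathsf X_i$ be the character table of $G_i$ and $\mathsf Y=\mathrm{diag}(\mathsf X_1,\dots,\mathsf X_n)$. Let $C^i_h$ denote the conjugacy class of $h$ in $G_i$ and $z_h$ the size of the centralizer of $h$ in $G_i$.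 **Theorem (Solomon-type formulas).** $\mathsf C$ is block upper triangular with diagonal blocks $\mathsf X_1,\dots,\mathsf X_n$. There are unique matrices $\mathsf A$ and $\mathsf B$ with $\mathsf C=\mathsf Y\mathsf A$ and $\mathsf C=\mathsf B\mathsf Y$; both are block upper unitriangular, hence invertible, and $\mathsf A_{C^i_h,C^j_g}$ is the number of restrictions $t\le g$ of $g$ that are conjugate to $h$ in $S$. Every character $\theta$ of $S$ is uniquely of the form $\theta=\sum_\psi m_\psi\psi^*$ with $m_\psi\in\mathbb N$, the sum over $\psi\in\biguplus_j\mathrm{Irr}(G_j)$, and for every $i$ and every $\chi\in\mathrm{Irr}(G_i)$ the multiplicity $m_\chi$ of $\chi^*$ in $\theta$ equals $(\chi,\theta)_S$, and $$(\chi,\theta)_S=\sum_{C^i_h}\chi(h^{-1})\,z_h^{-1}\sum_{C^j_g}(\mathsf A^{-1})_{C^j_g,C^i_h}\,\theta(g),$$ where the first sum is over the conjugacy classes of $G_i$ and the second over all conjugacy classes of all the $G_j$; and $$(\chi,\theta)_S=\sum_{j=1}^n\sum_{\psi\in\mathrm{Irr}(G_j)}(\mathsf B^{-1})_{\psi,\chi}\,(\psi,\theta|_{G_j})_{G_j}.$$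 -/

import Mathlib

/-- An inverse semigroup: every `s` has a unique `t` with `s t s = s` and `t s t = t`,
and this `t` is denoted `s⁻¹`. -/
class InverseSemigroup (S : Type*) extends Semigroup S, Inv S where
  mul_inv_mul : ∀ s : S, s * s⁻¹ * s = s
  inv_mul_inv : ∀ s : S, s⁻¹ * s * s⁻¹ = s⁻¹
  inv_unique : ∀ s t : S, s * t * s = s → t * s * t = t → t = s⁻¹

namespace InverseSemigroup

section Basic

variable {S : Type*} [InverseSemigroup S]

theorem mul_inv_mul_assoc (s t : S) : s * (s⁻¹ * (s * t)) = s * t := by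
  rw [← mul_assoc, ← mul_assoc, mul_inv_mul]

theorem inv_mul_inv_assoc (s t : S) : s⁻¹ * (s * (s⁻¹ * t)) = s⁻¹ * t := by
  rw [← mul_assoc, ← mul_assoc, inv_mul_inv]

theorem mul_inv_mul' (s : S) : s * (s⁻¹ * s) = s := by
  rw [← mul_assoc, mul_inv_mul]

theorem inv_mul_inv' (s : S) : s⁻¹ * (s * s⁻¹) = s⁻¹ := by
  rw [← mul_assoc, inv_mul_inv]

theorem inv_inv_eq (s : S) : s⁻¹⁻¹ = s :=
  (inv_unique s⁻¹ s (inv_mul_inv s) (mul_inv_mul s)).symm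

theorem inv_eq_of_idem {e : S} (he : e * e = e) : e⁻¹ = e :=
  (inv_unique e e (by rw [he, he]) (by rw [he, he])).symm

theorem idem_mul_aux {e f : S} (he : e * e = e) (hf : f * f = f) :
    (e * f) * (e * f) = e * f := by
  have h1 := mul_inv_mul (e * f)
  have h2 := inv_mul_inv (e * f)
  generalize hx : (e * f)⁻¹ = x at h1 h2
  have h3 : f * x * e = x := by
    rw [← hx]
    apply inv_unique
    · rw [hx]
      calc e * f * (f * x * e) * (e * f) = e * (f * f) * x * (e * e) * f := by
            simp only [mul_assoc]
        _ = e * f * x * (e * f) := by rw [he, hf]; simp only [mul_assoc]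
        _ = e * f := h1
    · rw [hx]
      calc f * x * e * (e * f) * (f * x * e) = f * (x * ((e * e) * (f * f)) * x) * e := by
            simp only [mul_assoc]
        _ = f * x * e := by rw [he, hf, h2]
  have h4 : x * x = x := by
    calc x * x = (f * x * e) * (f * x * e) := by rw [h3]
      _ = f * (x * (e * f) * x) * e := by simp only [mul_assoc]
      _ = x := by rw [h2, h3]
  have h5 : e * f = x := by
    rw [← inv_inv_eq (e * f), hx, inv_eq_of_idem h4]
  rw [h5, h4]

/-- Idempotents of an inverse semigroup commute. -/
theorem idem_comm {e f : S} (he : e * e = e) (hf : f * f = f) : e * f = f * e := by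
  have h1 := idem_mul_aux he hf
  have h2 := idem_mul_aux hf he
  have h3 : f * e = (e * f)⁻¹ := by
    apply inv_unique
    · calc e * f * (f * e) * (e * f) = e * (f * f) * (e * e) * f := by simp only [mul_assoc]
        _ = (e * f) * (e * f) := by rw [he, hf]; simp only [mul_assoc]
        _ = e * f := h1
    · calc f * e * (e * f) * (f * e) = f * (e * e) * (f * f) * e := by simp only [mul_assoc]
        _ = (f * e) * (f * e) := by rw [he, hf]; simp only [mul_assoc]
        _ = f * e := h2
  rw [h3, inv_eq_of_idem h1]

theorem idem_dom (s : S) : (s * s⁻¹) * (s * s⁻¹) = s * s⁻¹ := by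
  rw [← mul_assoc, mul_inv_mul]

theorem idem_ran (s : S) : (s⁻¹ * s) * (s⁻¹ * s) = s⁻¹ * s := by
  rw [← mul_assoc, inv_mul_inv]

theorem mul_inv_eq (s t : S) : (s * t)⁻¹ = t⁻¹ * s⁻¹ := by
  symm
  apply inv_unique
  · calc s * t * (t⁻¹ * s⁻¹) * (s * t) = s * ((t * t⁻¹) * (s⁻¹ * s)) * t := by
          simp only [mul_assoc]
      _ = s * ((s⁻¹ * s) * (t * t⁻¹)) * t := by rw [idem_comm (idem_dom t) (idem_ran s)]
      _ = (s * s⁻¹ * s) * (t * t⁻¹ * t) := by simp only [mul_assoc]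
      _ = s * t := by rw [mul_inv_mul, mul_inv_mul]
  · calc t⁻¹ * s⁻¹ * (s * t) * (t⁻¹ * s⁻¹) = t⁻¹ * ((s⁻¹ * s) * (t * t⁻¹)) * s⁻¹ := by
          simp only [mul_assoc]
      _ = t⁻¹ * ((t * t⁻¹) * (s⁻¹ * s)) * s⁻¹ := by rw [idem_comm (idem_dom t) (idem_ran s)]
      _ = (t⁻¹ * t * t⁻¹) * (s⁻¹ * s * s⁻¹) := by simp only [mul_assoc]
      _ = t⁻¹ * s⁻¹ := by rw [inv_mul_inv, inv_mul_inv]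

/-- The natural partial order: `s ≤ t` iff `s = e t` for some idempotent `e`. -/
instance : PartialOrder S where
  le s t := ∃ e : S, e * e = e ∧ s = e * t
  le_refl s := ⟨s * s⁻¹, idem_dom s, (mul_inv_mul s).symm⟩
  le_trans := by
    rintro s t u ⟨e, he, rfl⟩ ⟨f, hf, rfl⟩
    exact ⟨e * f, idem_mul_aux he hf, by rw [mul_assoc]⟩
  le_antisymm := by
    rintro s t ⟨e, he, h1⟩ ⟨f, hf, h2⟩
    have h3 : e * s = s := by rw [h1, ← mul_assoc, he]
    calc s = e * (f * s) := by rw [← h2, ← h1]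
      _ = f * (e * s) := by rw [← mul_assoc, idem_comm he hf, mul_assoc]
      _ = t := by rw [h3, ← h2]

theorem le_def {s t : S} : s ≤ t ↔ ∃ e : S, e * e = e ∧ s = e * t := Iff.rfl

theorem le_iff_dom_mul {s t : S} : s ≤ t ↔ s = s * s⁻¹ * t := by
  constructor
  · rintro ⟨e, he, h⟩
    have h3 : e * s = s := by rw [h, ← mul_assoc, he]
    have h4 : (s * s⁻¹) * e = s * s⁻¹ := by
      rw [idem_comm (idem_dom s) he, ← mul_assoc, h3]
    calc s = s * s⁻¹ * s := (mul_inv_mul s).symm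
      _ = s * s⁻¹ * (e * t) := by rw [← h]
      _ = s * s⁻¹ * t := by rw [← mul_assoc, h4]
  · intro h
    exact ⟨_, idem_dom s, h⟩

theorem le_iff_mul_ran {s t : S} : s ≤ t ↔ s = t * (s⁻¹ * s) := by
  constructor
  · intro h
    have h1 := le_iff_dom_mul.1 h
    have h2 : s⁻¹ = t⁻¹ * (s * s⁻¹) := by
      conv_lhs => rw [h1, mul_inv_eq, inv_eq_of_idem (idem_dom s)]
    calc s = s * s⁻¹ * (t * t⁻¹ * t) := by rw [mul_inv_mul]; exact h1
      _ = ((s * s⁻¹) * (t * t⁻¹)) * t := by simp only [mul_assoc]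
      _ = ((t * t⁻¹) * (s * s⁻¹)) * t := by rw [idem_comm (idem_dom s) (idem_dom t)]
      _ = t * ((t⁻¹ * (s * s⁻¹)) * t) := by simp only [mul_assoc]
      _ = t * (s⁻¹ * t) := by rw [← h2]
      _ = t * (s⁻¹ * s) := by
        congr 1
        calc s⁻¹ * t = s⁻¹ * s * s⁻¹ * t := by rw [inv_mul_inv]
          _ = s⁻¹ * (s * s⁻¹ * t) := by simp only [mul_assoc]
          _ = s⁻¹ * s := by rw [← h1]
  · intro h
    refine ⟨t * (s⁻¹ * s) * t⁻¹, ?_, ?_⟩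
    · calc t * (s⁻¹ * s) * t⁻¹ * (t * (s⁻¹ * s) * t⁻¹)
          = t * ((s⁻¹ * s) * (t⁻¹ * t)) * (s⁻¹ * s) * t⁻¹ := by simp only [mul_assoc]
        _ = t * ((t⁻¹ * t) * (s⁻¹ * s)) * (s⁻¹ * s) * t⁻¹ := by
          rw [idem_comm (idem_ran s) (idem_ran t)]
        _ = (t * t⁻¹ * t) * ((s⁻¹ * s) * (s⁻¹ * s)) * t⁻¹ := by simp only [mul_assoc]
        _ = t * (s⁻¹ * s) * t⁻¹ := by rw [mul_inv_mul, idem_ran]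
    · calc s = t * (s⁻¹ * s) := h
        _ = (t * t⁻¹ * t) * (s⁻¹ * s) := by rw [mul_inv_mul]
        _ = t * ((t⁻¹ * t) * (s⁻¹ * s)) := by simp only [mul_assoc]
        _ = t * ((s⁻¹ * s) * (t⁻¹ * t)) := by rw [idem_comm (idem_ran s) (idem_ran t)]
        _ = t * (s⁻¹ * s) * t⁻¹ * t := by simp only [mul_assoc]

end Basic

section Structure

variable {S : Type*} [InverseSemigroup S]

/-- The set `E(S)` of idempotents, with the order inherited from the natural partial order. -/
abbrev Idem (S : Type*) [InverseSemigroup S] : Type _ := {e : S // e * e = e}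

/-- `dom s = s s⁻¹`. -/
def dom (s : S) : Idem S := ⟨s * s⁻¹, idem_dom s⟩

/-- `ran s = s⁻¹ s`. -/
def ran (s : S) : Idem S := ⟨s⁻¹ * s, idem_ran s⟩

theorem Idem.le_iff {e f : Idem S} : e ≤ f ↔ (e : S) * f = e := by
  change (e : S) ≤ f ↔ _
  rw [le_iff_dom_mul, inv_eq_of_idem e.2, e.2, eq_comm]

theorem dom_idem (e : Idem S) : dom (e : S) = e :=
  Subtype.ext (by change (e : S) * (e : S)⁻¹ = e; rw [inv_eq_of_idem e.2, e.2])

theorem ran_idem (e : Idem S) : ran (e : S) = e :=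
  Subtype.ext (by change (e : S)⁻¹ * (e : S) = e; rw [inv_eq_of_idem e.2, e.2])

theorem dom_mul_self (s : S) : (dom s : S) * s = s := mul_inv_mul s

theorem mul_ran_self (s : S) : s * (ran s : S) = s := mul_inv_mul' s

theorem dom_inv (s : S) : dom s⁻¹ = ran s :=
  Subtype.ext (by simp only [dom, ran, inv_inv_eq])

theorem ran_inv (s : S) : ran s⁻¹ = dom s :=
  Subtype.ext (by simp only [dom, ran, inv_inv_eq])

theorem dom_mul {s t : S} (h : ran s = dom t) : dom (s * t) = dom s := by
  have h' : s⁻¹ * s = t * t⁻¹ := congrArg Subtype.val h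
  apply Subtype.ext
  calc s * t * (s * t)⁻¹ = s * (t * t⁻¹) * s⁻¹ := by rw [mul_inv_eq]; simp only [mul_assoc]
    _ = s * s⁻¹ := by rw [← h', mul_inv_mul']

theorem ran_mul {s t : S} (h : ran s = dom t) : ran (s * t) = ran t := by
  have h' : s⁻¹ * s = t * t⁻¹ := congrArg Subtype.val h
  apply Subtype.ext
  calc (s * t)⁻¹ * (s * t) = t⁻¹ * (s⁻¹ * s) * t := by rw [mul_inv_eq]; simp only [mul_assoc]
    _ = t⁻¹ * t := by rw [h', mul_assoc, mul_inv_mul]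

/-- Isomorphic idempotents: `e = dom s` and `f = ran s` for some `s`. -/
def IsoIdem (e f : Idem S) : Prop := ∃ s : S, dom s = e ∧ ran s = f

/-- The preorder on idempotents: `e` is isomorphic to an idempotent below `f`. -/
def Preceq (e f : Idem S) : Prop := ∃ e' : Idem S, IsoIdem e e' ∧ e' ≤ f

/-- The maximal subgroup `G_e` at an idempotent `e`. -/
def MaxSubgroup (e : Idem S) : Type _ := {s : S // dom s = e ∧ ran s = e}

instance (e : Idem S) : CoeOut (MaxSubgroup e) S := ⟨Subtype.val⟩

instance [Finite S] (e : Idem S) : Finite (MaxSubgroup e) :=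
  inferInstanceAs (Finite {s : S // dom s = e ∧ ran s = e})

/-- The group structure of `G_e`: the product and the inverse are those of `S`, the identity
is `e`. -/
instance (e : Idem S) : Group (MaxSubgroup e) where
  mul g h := ⟨g.1 * h.1,
    by rw [dom_mul (g.2.2.trans h.2.1.symm), g.2.1],
    by rw [ran_mul (g.2.2.trans h.2.1.symm), h.2.2]⟩
  one := ⟨e.1, dom_idem e, ran_idem e⟩
  inv g := ⟨g.1⁻¹, by rw [dom_inv, g.2.2], by rw [ran_inv, g.2.1]⟩
  mul_assoc a b c := Subtype.ext (mul_assoc a.1 b.1 c.1)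
  one_mul g := Subtype.ext (by
    change e.1 * g.1 = g.1
    conv_rhs => rw [← dom_mul_self g.1, g.2.1])
  mul_one g := Subtype.ext (by
    change g.1 * e.1 = g.1
    conv_rhs => rw [← mul_ran_self g.1, g.2.2])
  inv_mul_cancel g := Subtype.ext (show g.1⁻¹ * g.1 = e.1 from congrArg Subtype.val g.2.2)

/-- Conjugacy of elements `g ∈ G_e` and `h ∈ G_f` of maximal subgroups: `g = s h s⁻¹` for some
`s` with `dom s = e` and `ran s = f`. -/
def IsConjugate (g h : S) : Prop :=
  ∃ e f : Idem S, (dom g = e ∧ ran g = e) ∧ (dom h = f ∧ ran h = f) ∧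
    ∃ s : S, dom s = e ∧ ran s = f ∧ g = s * h * s⁻¹

/-- The number of restrictions of `g` (elements below `g`) that are conjugate to `h` in `S`. -/
noncomputable def restrictionCount (h g : S) : ℕ :=
  Nat.card {t : S // t ≤ g ∧ IsConjugate t h}

end Structure

section GroupCharacters

variable (G : Type*) [Group G]

/-- `Irr(G)`: the irreducible complex characters of `G`. -/
def Irr : Type _ :=
  {χ : G → ℂ // ∃ (n : ℕ) (ρ : Representation ℂ G (Fin n → ℂ)),
    ρ.IsIrreducible ∧ ρ.character = χ}

variable {G}

instance : CoeFun (Irr G) (fun _ => G → ℂ) := ⟨Subtype.val⟩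

/-- The degree of an irreducible character, as the size of a chosen matrix representation. -/
noncomputable def Irr.deg (χ : Irr G) : ℕ := χ.2.choose

/-- A chosen representation affording an irreducible character. -/
noncomputable def Irr.rep (χ : Irr G) : Representation ℂ G (Fin χ.deg → ℂ) :=
  χ.2.choose_spec.choose

theorem Irr.isIrreducible_rep (χ : Irr G) : χ.rep.IsIrreducible :=
  χ.2.choose_spec.choose_spec.1

theorem Irr.character_rep (χ : Irr G) : χ.rep.character = χ :=
  χ.2.choose_spec.choose_spec.2

/-- The bilinear form `(ψ, α)_G = |G|⁻¹ ∑ ψ(g⁻¹) α(g)` on functions on a finite group. -/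
noncomputable def groupForm [Finite G] (ψ α : G → ℂ) : ℂ :=
  letI := Fintype.ofFinite G
  (Nat.card G : ℂ)⁻¹ * ∑ g : G, ψ g⁻¹ * α g

theorem Irr.groupForm_eq [Finite G] (ψ χ : Irr G) [Decidable (ψ = χ)] :
    groupForm ψ χ = if ψ = χ then 1 else 0 := by
  let _ := Fintype.ofFinite G
  let _ : Invertible (Nat.card G : ℂ) := invertibleOfNonzero (by simp)
  have h1 := ψ.isIrreducible_rep
  have h2 := χ.isIrreducible_rep
  have h := Representation.char_orthonormal χ.rep ψ.rep
  rw [character_rep, character_rep] at h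
  have h3 : groupForm ψ χ = (Nat.card G : ℂ)⁻¹ * ∑ g : G, χ g * ψ g⁻¹ := by
    simp only [groupForm, mul_comm]
  rw [h3, h]
  by_cases hc : ψ = χ
  · subst hc
    rw [if_pos ⟨Representation.Equiv.refl _⟩, if_pos rfl]
  · rw [if_neg hc, if_neg]
    rintro ⟨e⟩
    apply hc
    apply Subtype.ext
    have := Representation.char_iso e
    rwa [character_rep, character_rep] at this

instance [Finite G] : Finite (Irr G) := by
  classical
  let _ := Fintype.ofFinite G
  have hli : LinearIndependent ℂ (fun χ : Irr G => (χ : G → ℂ)) := by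
    rw [linearIndependent_iff']
    intro s c hc χ hχ
    have h1 : ∑ ψ ∈ s, c ψ * groupForm χ ψ = 0 := by
      have : ∑ ψ ∈ s, c ψ * groupForm χ ψ
          = groupForm χ (∑ ψ ∈ s, c ψ • (ψ : G → ℂ)) := by
        simp only [groupForm, Finset.sum_apply, Pi.smul_apply, smul_eq_mul, Finset.mul_sum]
        rw [Finset.sum_comm]
        exact Finset.sum_congr rfl fun g _ => Finset.sum_congr rfl fun ψ _ => by ring
      rw [this, hc]
      simp [groupForm]
    simpa [Irr.groupForm_eq, hχ] using h1
  exact hli.finite_of_isNoetherian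

/-- A chosen element of a conjugacy class. -/
noncomputable def classRep (c : ConjClasses G) : G := Quotient.out (s := IsConj.setoid G) c

theorem mk_classRep (c : ConjClasses G) : ConjClasses.mk (classRep c) = c :=
  Quotient.out_eq (s := IsConj.setoid G) c

/-- The size `z_h` of the centralizer of `h` in `G`. -/
noncomputable def centralizerSize (h : G) : ℕ := Nat.card (Subgroup.centralizer ({h} : Set G))

/-- The character table of a group, with rows indexed by the irreducible characters and columns
by the conjugacy classes. -/
noncomputable def groupTable (G : Type*) [Group G] : Matrix (Irr G) (ConjClasses G) ℂ :=
  Matrix.of fun χ c => χ (classRep c)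

end GroupCharacters

section Induced

variable {S : Type*} [InverseSemigroup S]

/-- The idempotents isomorphic to `e`. -/
abbrev IsoClass (e : Idem S) : Type _ := {f : Idem S // IsoIdem e f}

/-- The `𝒟`-class of `e`: the elements whose domain is isomorphic to `e`. -/
abbrev DClass (e : Idem S) : Type _ := {s : S // IsoIdem e (dom s)}

theorem isoIdem_ran {e : Idem S} (t : DClass e) : IsoIdem e (ran t.1) := by
  obtain ⟨p, hp1, hp2⟩ := t.2
  exact ⟨p * t.1, by rw [dom_mul hp2, hp1], ran_mul hp2⟩

/-- The domain of an element of the `𝒟`-class of `e`. -/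
def DClass.dom {e : Idem S} (t : DClass e) : IsoClass e := ⟨InverseSemigroup.dom t.1, t.2⟩

/-- The range of an element of the `𝒟`-class of `e`. -/
def DClass.ran {e : Idem S} (t : DClass e) : IsoClass e :=
  ⟨InverseSemigroup.ran t.1, isoIdem_ran t⟩

theorem exists_connector (e : Idem S) : ∃ p : IsoClass e → S,
    (∀ f, dom (p f) = e ∧ ran (p f) = f.1) ∧ ∀ f, f.1 = e → p f = e := by
  classical
  refine ⟨fun f => if f.1 = e then e else f.2.choose, fun f => ?_, fun f h => if_pos h⟩
  by_cases h : f.1 = e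
  · simp only [if_pos h]
    exact ⟨dom_idem e, (ran_idem e).trans h.symm⟩
  · simp only [if_neg h]
    exact f.2.choose_spec

/-- Fixed elements `p_f` with `dom p_f = e`, `ran p_f = f`, for `f` isomorphic to `e`,
and `p_e = e`. -/
noncomputable def connector (e : Idem S) : IsoClass e → S := (exists_connector e).choose

theorem dom_connector {e : Idem S} (f : IsoClass e) : dom (connector e f) = e :=
  ((exists_connector e).choose_spec.1 f).1

theorem ran_connector {e : Idem S} (f : IsoClass e) : ran (connector e f) = f.1 :=
  ((exists_connector e).choose_spec.1 f).2

/-- The element `p_f t p_{f'}⁻¹` of `G_e`, for `t` in the `𝒟`-class of `e` with domain `f` and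
range `f'`. -/
noncomputable def loop {e : Idem S} (t : DClass e) : MaxSubgroup e :=
  ⟨connector e t.dom * t.1 * (connector e t.ran)⁻¹, by
    have h1 : ran (connector e t.dom) = dom t.1 := ran_connector _
    have h2 : ran (connector e t.dom * t.1) = dom (connector e t.ran)⁻¹ := by
      rw [ran_mul h1, dom_inv, ran_connector]; rfl
    rw [dom_mul h2, ran_mul h2, dom_mul h1, ran_inv, dom_connector, dom_connector]
    exact ⟨rfl, rfl⟩⟩

/-- The product in the `𝒟`-class, when the range of `t` is the domain of `u`. -/
def DClass.comp {e : Idem S} (t u : DClass e) (h : t.ran = u.dom) : DClass e :=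
  ⟨t.1 * u.1, by rw [dom_mul (congrArg Subtype.val h)]; exact t.2⟩

theorem loop_comp {e : Idem S} (t u : DClass e) (h : t.ran = u.dom) :
    loop t * loop u = loop (t.comp u h) := by
  have h0 : InverseSemigroup.ran t.1 = InverseSemigroup.dom u.1 := congrArg Subtype.val h
  have hd : (t.comp u h).dom = t.dom := Subtype.ext (dom_mul h0)
  have hr : (t.comp u h).ran = u.ran := Subtype.ext (ran_mul h0)
  apply Subtype.ext
  change connector e t.dom * t.1 * (connector e t.ran)⁻¹ *
      (connector e u.dom * u.1 * (connector e u.ran)⁻¹) =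
    connector e (t.comp u h).dom * (t.1 * u.1) * (connector e (t.comp u h).ran)⁻¹
  rw [hd, hr, h]
  have h3 : (connector e u.dom)⁻¹ * connector e u.dom = (InverseSemigroup.dom u.1 : S) :=
    congrArg Subtype.val (ran_connector u.dom)
  calc connector e t.dom * t.1 * (connector e u.dom)⁻¹ *
        (connector e u.dom * u.1 * (connector e u.ran)⁻¹)
      = connector e t.dom * t.1 * (((connector e u.dom)⁻¹ * connector e u.dom) * u.1) *
        (connector e u.ran)⁻¹ := by simp only [mul_assoc]
    _ = _ := by rw [h3, dom_mul_self]; simp only [mul_assoc]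

variable {V : Type*} [AddCommGroup V] [Module ℂ V]

open scoped Classical in
/-- The action on `V^{n_e}` (one copy of `V` for each idempotent isomorphic to `e`) of the element
`⌊t⌋` of the semigroup algebra, for `t` in the `𝒟`-class of `e`: it is the block matrix whose only
nonzero block is `φ (p_f t p_{f'}⁻¹)`, in position `(f, f') = (dom t, ran t)`. -/
noncomputable def floorAction {e : Idem S} (φ : Representation ℂ (MaxSubgroup e) V)
    (t : DClass e) : Module.End ℂ (IsoClass e → V) :=
  LinearMap.single ℂ (fun _ : IsoClass e => V) t.dom ∘ₗ φ (loop t) ∘ₗ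
    LinearMap.proj (R := ℂ) (φ := fun _ : IsoClass e => V) t.ran

theorem floorAction_mul {e : Idem S} (φ : Representation ℂ (MaxSubgroup e) V)
    (t u : DClass e) (h : t.ran = u.dom) :
    floorAction φ t * floorAction φ u = floorAction φ (t.comp u h) := by
  have h0 : InverseSemigroup.ran t.1 = InverseSemigroup.dom u.1 := congrArg Subtype.val h
  have hd : (t.comp u h).dom = t.dom := Subtype.ext (dom_mul h0)
  have hr : (t.comp u h).ran = u.ran := Subtype.ext (ran_mul h0)
  apply LinearMap.ext
  intro v
  simp [floorAction, ← loop_comp t u h, hd, hr, h]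

theorem floorAction_mul_of_ne {e : Idem S} (φ : Representation ℂ (MaxSubgroup e) V)
    (t u : DClass e) (h : t.ran ≠ u.dom) :
    floorAction φ t * floorAction φ u = 0 := by
  apply LinearMap.ext
  intro v
  simp [floorAction, h]

open scoped Classical in
/-- The action of `s = ∑_{t ≤ s} ⌊t⌋`, where `⌊t⌋` acts as zero for `t` outside the
`𝒟`-class of `e`. -/
noncomputable def starAction [Finite S] {e : Idem S} (φ : Representation ℂ (MaxSubgroup e) V)
    (s : S) : Module.End ℂ (IsoClass e → V) :=
  letI := Fintype.ofFinite (DClass e)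
  ∑ t : DClass e, if t.1 ≤ s then floorAction φ t else 0

theorem mul_le_mul_of_le {s s' t t' : S} (h1 : s' ≤ s) (h2 : t' ≤ t) : s' * t' ≤ s * t := by
  have a1 := le_iff_mul_ran.1 h1
  have a2 := le_iff_dom_mul.1 h2
  have h3 : s' * t' ≤ s * t' := by
    rw [le_iff_dom_mul] at h1
    exact ⟨s' * s'⁻¹, idem_dom s', by rw [← mul_assoc, ← h1]⟩
  have h4 : s * t' ≤ s * t := by
    have h5 := le_iff_mul_ran.1 h2
    rw [le_iff_mul_ran]
    have : (s * t') * (t'⁻¹ * t') = s * t' := by rw [mul_assoc, mul_inv_mul']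
    calc s * t' = (s * t') * ((s * t')⁻¹ * (s * t')) := (mul_inv_mul' _).symm
      _ = s * (t * (t'⁻¹ * t')) * ((s * t')⁻¹ * (s * t')) := by rw [← h5]
      _ = s * t * ((t'⁻¹ * t') * ((s * t')⁻¹ * (s * t'))) := by simp only [mul_assoc]
      _ = s * t * (((s * t')⁻¹ * (s * t')) * (t'⁻¹ * t')) := by
        rw [idem_comm (idem_ran t') (idem_ran (s * t'))]
      _ = s * t * ((s * t')⁻¹ * ((s * t') * (t'⁻¹ * t'))) := by simp only [mul_assoc]
      _ = s * t * ((s * t')⁻¹ * (s * t')) := by rw [this]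
  exact h3.trans h4

theorem exists_factor {s s' w : S} (h : w ≤ s * s') :
    ∃ t u : S, t ≤ s ∧ u ≤ s' ∧ ran t = dom u ∧ t * u = w := by
  have h1 : w * (w⁻¹ * (s * s')) = w := by
    rw [← mul_assoc]; exact (le_iff_dom_mul.1 h).symm
  have h2 : s * (s' * (w⁻¹ * w)) = w := by
    rw [← mul_assoc]; exact (le_iff_mul_ran.1 h).symm
  have h3 : s' * w⁻¹ = (w * w⁻¹ * s)⁻¹ := by
    apply inv_unique
    · calc w * w⁻¹ * s * (s' * w⁻¹) * (w * w⁻¹ * s)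
          = (w * (w⁻¹ * (s * s'))) * (w⁻¹ * w * w⁻¹) * s := by simp only [mul_assoc]
        _ = w * w⁻¹ * s := by rw [h1, inv_mul_inv]
    · calc s' * w⁻¹ * (w * w⁻¹ * s) * (s' * w⁻¹)
          = s' * w⁻¹ * (w * (w⁻¹ * (s * s'))) * w⁻¹ := by simp only [mul_assoc]
        _ = s' * (w⁻¹ * w * w⁻¹) := by rw [h1]; simp only [mul_assoc]
        _ = s' * w⁻¹ := by rw [inv_mul_inv]
  have h4 : w⁻¹ * s = (s' * (w⁻¹ * w))⁻¹ := by
    apply inv_unique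
    · calc s' * (w⁻¹ * w) * (w⁻¹ * s) * (s' * (w⁻¹ * w))
          = s' * (w⁻¹ * w * w⁻¹) * (s * (s' * (w⁻¹ * w))) := by simp only [mul_assoc]
        _ = s' * (w⁻¹ * w) := by rw [h2, inv_mul_inv, mul_assoc]
    · calc w⁻¹ * s * (s' * (w⁻¹ * w)) * (w⁻¹ * s)
          = w⁻¹ * (s * (s' * (w⁻¹ * w))) * w⁻¹ * s := by simp only [mul_assoc]
        _ = w⁻¹ * s := by rw [h2, inv_mul_inv]
  refine ⟨w * w⁻¹ * s, s' * (w⁻¹ * w), ⟨_, idem_dom w, rfl⟩, ?_, ?_, ?_⟩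
  · rw [le_iff_mul_ran, ← h4]
    have : w⁻¹ * s * (s' * (w⁻¹ * w)) = w⁻¹ * w := by
      calc w⁻¹ * s * (s' * (w⁻¹ * w)) = w⁻¹ * (s * (s' * (w⁻¹ * w))) := by
            simp only [mul_assoc]
        _ = w⁻¹ * w := by rw [h2]
    rw [this]
  · apply Subtype.ext
    change (w * w⁻¹ * s)⁻¹ * (w * w⁻¹ * s) = s' * (w⁻¹ * w) * (s' * (w⁻¹ * w))⁻¹
    rw [← h3, ← h4]
    simp only [mul_assoc]
  · calc w * w⁻¹ * s * (s' * (w⁻¹ * w)) = w * (w⁻¹ * (s * (s' * (w⁻¹ * w)))) := by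
          simp only [mul_assoc]
      _ = w := by rw [h2, mul_inv_mul']

theorem factor_unique {s s' t u : S} (ht : t ≤ s) (hu : u ≤ s') (h : ran t = dom u) :
    t = (dom (t * u) : S) * s ∧ u = s' * (ran (t * u) : S) := by
  rw [dom_mul h, ran_mul h]
  exact ⟨le_iff_dom_mul.1 ht, le_iff_mul_ran.1 hu⟩

theorem starAction_mul [Finite S] {e : Idem S} (φ : Representation ℂ (MaxSubgroup e) V)
    (s s' : S) : starAction φ (s * s') = starAction φ s * starAction φ s' := by
  classical
  let _ := Fintype.ofFinite (DClass e)
  have key : ∀ t u : DClass e,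
      ((if t.1 ≤ s then floorAction φ t else 0) * (if u.1 ≤ s' then floorAction φ u else 0)) =
      if t.1 ≤ s ∧ u.1 ≤ s' ∧ t.ran = u.dom then floorAction φ t * floorAction φ u else 0 := by
    intro t u
    by_cases h1 : t.1 ≤ s <;> by_cases h2 : u.1 ≤ s' <;> by_cases h3 : t.ran = u.dom <;>
      simp [h1, h2, h3, floorAction_mul_of_ne]
  have hR : starAction φ s * starAction φ s' = ∑ x : DClass e × DClass e,
      if x.1.1 ≤ s ∧ x.2.1 ≤ s' ∧ x.1.ran = x.2.dom then
        floorAction φ x.1 * floorAction φ x.2 else 0 := by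
    change (∑ t : DClass e, _) * (∑ u : DClass e, _) = _
    rw [Finset.sum_mul_sum, ← Finset.sum_product', Finset.univ_product_univ]
    exact Finset.sum_congr rfl fun x _ => key x.1 x.2
  rw [hR, ← Finset.sum_filter]
  change (∑ w : DClass e, _) = _
  rw [← Finset.sum_filter]
  symm
  refine Finset.sum_bij
    (fun x hx => x.1.comp x.2 (Finset.mem_filter.1 hx).2.2.2) ?_ ?_ ?_ ?_
  · intro x hx
    have h := (Finset.mem_filter.1 hx).2
    exact Finset.mem_filter.2 ⟨Finset.mem_univ _, mul_le_mul_of_le h.1 h.2.1⟩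
  · intro x hx y hy hxy
    have h := (Finset.mem_filter.1 hx).2
    have k := (Finset.mem_filter.1 hy).2
    have hxy' : x.1.1 * x.2.1 = y.1.1 * y.2.1 := congrArg Subtype.val hxy
    have f1 := factor_unique h.1 h.2.1 (congrArg Subtype.val h.2.2)
    have f2 := factor_unique k.1 k.2.1 (congrArg Subtype.val k.2.2)
    rw [hxy'] at f1
    exact Prod.ext (Subtype.ext (f1.1.trans f2.1.symm)) (Subtype.ext (f1.2.trans f2.2.symm))
  · intro w hw
    obtain ⟨t, u, ht, hu, h, rfl'⟩ := exists_factor (Finset.mem_filter.1 hw).2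
    have ht' : IsoIdem e (dom t) := by
      rw [← dom_mul h, rfl']; exact w.2
    have hu' : IsoIdem e (dom u) := by
      rw [← h]; exact isoIdem_ran ⟨t, ht'⟩
    exact ⟨(⟨t, ht'⟩, ⟨u, hu'⟩), Finset.mem_filter.2 ⟨Finset.mem_univ _, ht, hu, Subtype.ext h⟩,
      Subtype.ext rfl'⟩
  · intro x hx
    exact floorAction_mul φ x.1 x.2 _

/-- The representation `φ^*` of `S` induced by the representation `φ` of `G_e`. -/
noncomputable def starRep [Finite S] {e : Idem S} (φ : Representation ℂ (MaxSubgroup e) V) :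
    S →ₙ* Module.End ℂ (IsoClass e → V) where
  toFun := starAction φ
  map_mul' := starAction_mul φ

/-- The character `χ^*` of `S`, for an irreducible character `χ` of `G_e`. -/
noncomputable def starChar [Finite S] {e : Idem S} (χ : Irr (MaxSubgroup e)) (s : S) : ℂ :=
  LinearMap.trace ℂ _ (starRep χ.rep s)

end Induced

section Multiplicity

variable {S : Type*} [InverseSemigroup S]

/-- Complex characters of the semigroup `S`: traces of finite-dimensional representations. -/
def IsCharacter (θ : S → ℂ) : Prop :=
  ∃ (n : ℕ) (ρ : S →ₙ* Module.End ℂ (Fin n → ℂ)), ∀ s, θ s = LinearMap.trace ℂ _ (ρ s)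

open scoped Classical in
/-- The form `(χ, θ)_S = ∑_{f ≤ e} (χ, θ_f)_{G_e} μ(f, e)`, where `θ_f(s) = θ(f s)` and `μ` is the
Möbius function of the poset of idempotents. -/
noncomputable def semigroupForm [Finite S] {e : Idem S} (χ : MaxSubgroup e → ℂ) (θ : S → ℂ) : ℂ :=
  letI := Fintype.ofFinite (Idem S)
  letI : LocallyFiniteOrder (Idem S) := Fintype.toLocallyFiniteOrder
  ∑ f : Idem S, if f ≤ e then
    groupForm χ (fun g => θ ((f : S) * (g : S))) * IncidenceAlgebra.mu ℂ f e else 0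

/-- `e_1, …, e_n` represent the isomorphism classes of idempotents, each exactly once, and are
numbered so that `e_i ⪯ e_j` implies `i ≤ j`. -/
structure IsOrderedTransversal {n : ℕ} (e : Fin n → Idem S) : Prop where
  exists_iso : ∀ f : Idem S, ∃ i, IsoIdem (e i) f
  eq_of_iso : ∀ i j, IsoIdem (e i) (e j) → i = j
  le_of_preceq : ∀ i j, Preceq (e i) (e j) → i ≤ j

/-- The disjoint union of the sets `Irr(G_i)`. -/
abbrev IrrLabel {n : ℕ} (e : Fin n → Idem S) : Type _ := Σ i, Irr (MaxSubgroup (e i))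

/-- The disjoint union of the sets of conjugacy classes of the `G_i`. -/
abbrev ClassLabel {n : ℕ} (e : Fin n → Idem S) : Type _ := Σ i, ConjClasses (MaxSubgroup (e i))

noncomputable instance [Finite S] (e : Idem S) : Fintype (Irr (MaxSubgroup e)) :=
  Fintype.ofFinite _

noncomputable instance [Finite S] (e : Idem S) : Fintype (ConjClasses (MaxSubgroup e)) :=
  Fintype.ofFinite _

noncomputable instance (e : Idem S) : DecidableEq (Irr (MaxSubgroup e)) := Classical.decEq _

noncomputable instance (e : Idem S) : DecidableEq (ConjClasses (MaxSubgroup e)) :=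
  Classical.decEq _

/-- The character table `C` of `S`: the entry at `χ ∈ Irr(G_i)` and a conjugacy class of `G_j` is
the value of `χ^*` on that class. -/
noncomputable def charTable [Finite S] {n : ℕ} (e : Fin n → Idem S) :
    Matrix (IrrLabel e) (ClassLabel e) ℂ :=
  Matrix.of fun x c => starChar x.2 (classRep c.2 : MaxSubgroup (e c.1))

/-- The block diagonal matrix `Y` of the character tables of the `G_i`. -/
noncomputable def blockTable {n : ℕ} (e : Fin n → Idem S) :
    Matrix (IrrLabel e) (ClassLabel e) ℂ :=
  Matrix.blockDiagonal' fun i => groupTable (MaxSubgroup (e i))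

/-- Block upper unitriangular matrices: the blocks below the diagonal vanish and the diagonal
blocks are identity matrices. -/
structure IsBlockUpperUnitriangular {n : ℕ} {L : Fin n → Type*}
    (M : Matrix (Σ i, L i) (Σ i, L i) ℂ) : Prop where
  below : ∀ (i j : Fin n) (a : L i) (b : L j), j < i → M ⟨i, a⟩ ⟨j, b⟩ = 0
  diag_same : ∀ (i : Fin n) (a : L i), M ⟨i, a⟩ ⟨i, a⟩ = 1
  diag_ne : ∀ (i : Fin n) (a b : L i), a ≠ b → M ⟨i, a⟩ ⟨i, b⟩ = 0

end Multiplicity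

end InverseSemigroup

open InverseSemigroup

/-! Möbius inversion over the idempotents turns representations of `S` into representations of its
maximal subgroups. In a representation `ρ` the operators `floorIdem ρ e = ∑_{f ≤ e} μ(f,e) ρ(f)` are
pairwise orthogonal idempotents, and `ρ e` is the sum of those with `f ≤ e`. Every `ρ s` intertwines
the one at `ran s` with the one at `dom s` (`map_mul_floorIdem_ran`). Hence the trace of `ρ s` is
the sum over `t ≤ s` of `floorTrace ρ t`. A term vanishes unless `dom t = ran t`, and then it is the
value, at the loop of `t` in `G_e`, of the character of `G_e` on the range of `floorIdem ρ e`
(`floorTrace_loop`, `character_floorRep`). The characters `χ^*` satisfy a formula of the same shape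
(`starChar_eq_sum`). Expanding the group characters into irreducibles therefore writes `θ` as `∑ m_ψ
ψ^*`, where `m_χ` is the multiplicity of `χ` in `floorRep`. By `semigroupForm_trace` this number is
`(χ, θ)_S`.

The rest is linear algebra. Grouping the `t ≤ g` by the class of their loop gives `C = Y A` with `A`
the matrix of restriction counts. A restriction of `g ∈ G_j` conjugate to an element of `G_i` forces
`e_i ⪯ e_j`, so `A` is block triangular. In a finite semigroup an idempotent is not isomorphic to
one strictly below it (`IsoIdem.eq_of_le`), so the diagonal blocks of `A` are identities. The
orthogonality relations invert `Y`, which gives `B = C Y⁻¹`. If the row `v` lists the values of `θ`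
on class representatives, then `v = m C`, and so `m = v A⁻¹ Y⁻¹ = v Y⁻¹ B⁻¹`. These are the two
formulas, and the first also makes `m` unique. -/

namespace InverseSemigroup

/-! ### Finite groups: irreducible characters span the class functions, and the character table is
invertible. -/

section GroupCompleteness

variable {G : Type*} [Group G] [Finite G]

theorem groupForm_def [Fintype G] (ψ α : G → ℂ) :
    groupForm ψ α = (Nat.card G : ℂ)⁻¹ * ∑ g : G, ψ g⁻¹ * α g := by
  rw [groupForm]
  congr!

theorem groupForm_sum_right {ι : Type*} (s : Finset ι) (c : ι → ℂ) (α : ι → G → ℂ) (ψ : G → ℂ) :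
    groupForm ψ (fun g => ∑ i ∈ s, c i * α i g) = ∑ i ∈ s, c i * groupForm ψ (α i) := by
  let _ := Fintype.ofFinite G
  simp only [groupForm_def, Finset.mul_sum]
  rw [Finset.sum_comm]
  exact Finset.sum_congr rfl fun i _ => Finset.sum_congr rfl fun g _ => by ring

/-- A class function orthogonal to an irreducible character acts as zero on the representation. -/
theorem sum_smul_eq_zero_of_groupForm_eq_zero [Fintype G] {n : ℕ}
    (ρ : Representation ℂ G (Fin n → ℂ)) [hρ : ρ.IsIrreducible] {f : G → ℂ}
    (hf : ∀ g h, f (h * g * h⁻¹) = f g) (h0 : groupForm ρ.character f = 0) :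
    ∑ g : G, f g • ρ g⁻¹ = 0 := by
  classical
  set T : Module.End ℂ (Fin n → ℂ) := ∑ g : G, f g • ρ g⁻¹ with hT
  have hcomm : ∀ h : G, T ∘ₗ ρ h = ρ h ∘ₗ T := by
    intro h
    change T * ρ h = ρ h * T
    rw [hT, Finset.sum_mul, Finset.mul_sum]
    refine Fintype.sum_equiv (MulAut.conj h⁻¹).toEquiv _ _ fun g => ?_
    change _ = ρ h * (f (h⁻¹ * g * h⁻¹⁻¹) • ρ (h⁻¹ * g * h⁻¹⁻¹)⁻¹)
    rw [hf, smul_mul_assoc, mul_smul_comm, ← map_mul, ← map_mul]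
    congr 2
    group
  -- Schur's lemma makes `T` a scalar, and `h0` says that its trace is zero.
  let Ti : Representation.IntertwiningMap ρ ρ := ⟨T, hcomm⟩
  obtain ⟨c, hc⟩ :=
    (Representation.IsIrreducible.algebraMap_intertwiningMap_bijective_of_isAlgClosed
      (ρ := ρ)).2 Ti
  have hTc : T = c • LinearMap.id := by
    have := congrArg Representation.IntertwiningMap.toLinearMap hc
    rw [show T = Ti.toLinearMap from rfl, ← this]
    rfl
  have htr : LinearMap.trace ℂ _ T = 0 := by
    rw [groupForm_def] at h0
    have h1 : ∑ g : G, ρ.character g⁻¹ * f g = 0 :=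
      (mul_eq_zero.1 h0).resolve_left (inv_ne_zero (Nat.cast_ne_zero.2 Nat.card_pos.ne'))
    rw [hT, map_sum, ← h1]
    exact Finset.sum_congr rfl fun g _ => by
      rw [map_smul, smul_eq_mul, mul_comm]; rfl
  -- Irreducibility supplies two distinct subrepresentations, impossible in dimension zero; so trace
  -- zero forces the scalar to vanish.
  have hn : n ≠ 0 := by
    rintro rfl
    obtain ⟨W, W', hW⟩ := hρ.exists_pair_ne
    apply hW
    ext x
    rw [Subsingleton.elim x 0]
    exact iff_of_true (W.toSubmodule.zero_mem) (W'.toSubmodule.zero_mem)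
  rw [hTc, map_smul, LinearMap.trace_id, Module.finrank_fin_fun, smul_eq_mul] at htr
  rw [hTc, (mul_eq_zero.1 htr).resolve_right (Nat.cast_ne_zero.2 hn), zero_smul]

open MonoidAlgebra in
/-- A simple submodule of the group algebra is the space of an irreducible matrix
representation. -/
theorem exists_irreducible_of_isSimpleModule (N : Submodule (MonoidAlgebra ℂ G) (MonoidAlgebra ℂ G))
    [IsSimpleModule (MonoidAlgebra ℂ G) N] :
    ∃ (n : ℕ) (ρ : Representation ℂ G (Fin n → ℂ)) (b : N ≃ₗ[ℂ] (Fin n → ℂ)),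
      ρ.IsIrreducible ∧ ∀ g x, ρ g (b x) = b (MonoidAlgebra.of ℂ G g • x) := by
  have : FiniteDimensional ℂ N :=
    FiniteDimensional.of_injective (N.subtype.restrictScalars ℂ) N.injective_subtype
  let b : N ≃ₗ[ℂ] (Fin (Module.finrank ℂ N) → ℂ) := (Module.finBasis ℂ N).equivFun
  let τ : Representation ℂ G N := Representation.ofModule' N
  have hτ : ∀ g x, τ g x = MonoidAlgebra.of ℂ G g • x := fun g x => by
    simp [τ, Representation.ofModule']
  let ρ : Representation ℂ G (Fin (Module.finrank ℂ N) → ℂ) :=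
    (b.conjAlgEquiv ℂ : Module.End ℂ N →* _).comp τ
  have hρ : ∀ g x, ρ g (b x) = b (MonoidAlgebra.of ℂ G g • x) := fun g x => by
    rw [← hτ]
    simp [ρ, LinearEquiv.conjAlgEquiv]
  refine ⟨_, ρ, b, ?_, hρ⟩
  have hnt : Nontrivial N := IsSimpleModule.nontrivial (MonoidAlgebra ℂ G) N
  have key : ∀ W : Subrepresentation ρ, W = ⊥ ∨ W = ⊤ := by
    intro W
    let W' : Submodule (MonoidAlgebra ℂ G) N :=
      { W.toSubmodule.comap b.toLinearMap with
        smul_mem' := by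
          intro c x hx
          change b x ∈ W.toSubmodule at hx
          change b (c • x) ∈ W.toSubmodule
          induction c using MonoidAlgebra.induction_on with
          | of g => rw [← hρ]; exact W.apply_mem_toSubmodule g hx
          | add y z hy hz => rw [add_smul, map_add]; exact W.toSubmodule.add_mem hy hz
          | smul r y hy => rw [smul_assoc, map_smul]; exact W.toSubmodule.smul_mem r hy }
    have hW' : ∀ x, x ∈ W' ↔ b x ∈ W.toSubmodule := fun x => Iff.rfl
    rcases eq_bot_or_eq_top W' with h | h
    · left
      apply Subrepresentation.toSubmodule_injective
      refine (Submodule.eq_bot_iff _).2 fun y hy => ?_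
      have : b.symm y ∈ W' := by rw [hW', b.apply_symm_apply]; exact hy
      rw [h, Submodule.mem_bot] at this
      simpa using this
    · right
      apply Subrepresentation.toSubmodule_injective
      refine (Submodule.eq_top_iff').2 fun y => ?_
      have : b.symm y ∈ W' := by rw [h]; trivial
      rwa [hW', b.apply_symm_apply] at this
  have hne : (⊥ : Subrepresentation ρ) ≠ ⊤ := by
    intro h
    obtain ⟨x, hx⟩ := exists_ne (0 : N)
    have h1 : b x ∈ (⊥ : Subrepresentation ρ).toSubmodule := by rw [h]; trivial
    exact hx (by simpa using (Submodule.mem_bot ℂ).1 h1)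
  exact { exists_pair_ne := ⟨⊥, ⊤, hne⟩, eq_bot_or_eq_top := key }

/-- A class function orthogonal to all irreducible characters vanishes. -/
theorem eq_zero_of_groupForm_eq_zero {f : G → ℂ} (hf : ∀ g h, f (h * g * h⁻¹) = f g)
    (h0 : ∀ χ : Irr G, groupForm χ f = 0) : f = 0 := by
  classical
  let _ := Fintype.ofFinite G
  have : NeZero (Nat.card G : ℂ) := ⟨Nat.cast_ne_zero.2 Nat.card_pos.ne'⟩
  -- This element kills every simple submodule. By Maschke's theorem these span the group algebra,
  -- so `z = z • 1 = 0`, and the coefficients of `z` are the values of `f`.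
  let z : MonoidAlgebra ℂ G := ∑ g : G, f g • MonoidAlgebra.of ℂ G g⁻¹
  have hz : ∀ N : Submodule (MonoidAlgebra ℂ G) (MonoidAlgebra ℂ G),
      IsSimpleModule (MonoidAlgebra ℂ G) N → ∀ x : N, z • x = 0 := by
    intro N hN x
    obtain ⟨n, ρ, b, hirr, hb⟩ := exists_irreducible_of_isSimpleModule N
    have h1 := sum_smul_eq_zero_of_groupForm_eq_zero ρ hf (h0 ⟨ρ.character, n, ρ, hirr, rfl⟩)
    apply b.injective
    rw [map_zero, ← LinearMap.zero_apply (σ₁₂ := RingHom.id ℂ) (M₂ := Fin n → ℂ) (b x), ← h1]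
    simp only [z, Finset.sum_smul, map_sum, LinearMap.sum_apply, LinearMap.smul_apply, hb,
      smul_assoc, map_smul]
  have htop : ∀ x : MonoidAlgebra ℂ G, z • x = 0 := by
    intro x
    have hx : x ∈ sSup {m : Submodule (MonoidAlgebra ℂ G) (MonoidAlgebra ℂ G) |
        IsSimpleModule (MonoidAlgebra ℂ G) m} := by
      rw [IsSemisimpleModule.sSup_simples_eq_top]; trivial
    rw [sSup_eq_iSup'] at hx
    induction hx using Submodule.iSup_induction' with
    | mem N x hx => exact congrArg Subtype.val (hz N.1 N.2 ⟨x, hx⟩)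
    | zero => exact smul_zero z
    | add x y _ _ hx hy => rw [smul_add, hx, hy, add_zero]
  have hz0 : z = 0 := by simpa using htop 1
  funext g
  have := congrArg (fun w : MonoidAlgebra ℂ G => w.coeff g⁻¹) hz0
  simpa [z, Finsupp.single_apply] using this

/-- Class functions are determined by their products with the irreducible characters. -/
theorem eq_sum_irr [Fintype (Irr G)] {f : G → ℂ} (hf : ∀ g h, f (h * g * h⁻¹) = f g) (g : G) :
    f g = ∑ χ : Irr G, groupForm χ f * χ g := by
  classical
  have hχ : ∀ (χ : Irr G) (g h : G), χ (h * g * h⁻¹) = χ g := by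
    intro χ g h
    rw [← χ.character_rep, Representation.char_conj]
  have := eq_zero_of_groupForm_eq_zero
    (f := fun g => f g - ∑ χ : Irr G, groupForm χ f * χ g) (fun g h => by simp only [hf, hχ]) ?_
  · exact sub_eq_zero.1 (congrFun this g)
  · intro ψ
    have h1 : groupForm ψ (fun g => f g - ∑ χ : Irr G, groupForm χ f * χ g)
        = groupForm ψ f - groupForm ψ (fun g => ∑ χ : Irr G, groupForm χ f * χ g) := by
      let _ := Fintype.ofFinite G
      simp only [groupForm_def, mul_sub, Finset.sum_sub_distrib]
    rw [h1, groupForm_sum_right]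
    simp [Irr.groupForm_eq]

/-- The multiplicity of an irreducible character in a character is a natural number. -/
theorem groupForm_irr_character {V : Type*} [AddCommGroup V] [Module ℂ V] [FiniteDimensional ℂ V]
    (ρ : Representation ℂ G V) (χ : Irr G) : ∃ m : ℕ, groupForm χ ρ.character = m := by
  let _ := Fintype.ofFinite G
  let _ : Invertible (Nat.card G : ℂ) :=
    invertibleOfNonzero (Nat.cast_ne_zero.2 Nat.card_pos.ne')
  refine ⟨_, Eq.trans ?_ (Representation.card_inv_mul_sum_char_mul_char_eq_finrank χ.rep ρ)⟩
  rw [groupForm_def, χ.character_rep]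
  simp only [mul_comm]

omit [Finite G] in
theorem Irr.apply_eq_of_isConj (χ : Irr G) {g h : G} (hc : IsConj g h) : χ g = χ h := by
  obtain ⟨c, rfl⟩ := isConj_iff.1 hc
  rw [← χ.character_rep, Representation.char_conj]

omit [Finite G] in
theorem isConj_classRep (g : G) : IsConj (classRep (ConjClasses.mk g)) g :=
  ConjClasses.mk_eq_mk_iff_isConj.1 (mk_classRep _)

/-- Orbit–stabilizer for the conjugation action. -/
theorem card_conjClass_mul_centralizerSize (c : ConjClasses G) :
    Nat.card c.carrier * centralizerSize (classRep c) = Nat.card G := by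
  classical
  let _ := Fintype.ofFinite G
  rw [centralizerSize, Subgroup.nat_card_centralizer_nat_card_stabilizer]
  conv_lhs => rw [← mk_classRep c]
  rw [← ConjAct.orbit_eq_carrier_conjClasses, mk_classRep]
  simp only [Nat.card_eq_fintype_card]
  rw [MulAction.card_orbit_mul_card_stabilizer_eq_card_group, ConjAct.card]

omit [Finite G] in
theorem sum_eq_sum_conjClasses [Fintype G] [Fintype (ConjClasses G)] {F : G → ℂ}
    (hF : ∀ g h, IsConj g h → F g = F h) :
    ∑ g : G, F g = ∑ c : ConjClasses G, (Nat.card c.carrier : ℂ) * F (classRep c) := by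
  classical
  rw [← Finset.sum_fiberwise Finset.univ (ConjClasses.mk : G → ConjClasses G)]
  refine Finset.sum_congr rfl fun c _ => ?_
  rw [Finset.sum_congr rfl (g := fun _ => F (classRep c)), Finset.sum_const, nsmul_eq_mul]
  · congr 2
    rw [Nat.card_eq_fintype_card, Fintype.card_subtype]
    congr 1
    ext g
    simp [ConjClasses.mem_carrier_iff_mk_eq]
  · intro g hg
    rw [Finset.mem_filter] at hg
    rw [← hg.2]
    exact hF _ _ (isConj_classRep g).symm

/-- The form on class functions as a sum over the conjugacy classes. -/
theorem groupForm_eq_sum_conjClasses [Fintype (ConjClasses G)] (χ : Irr G) {f : G → ℂ}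
    (hf : ∀ g h, IsConj g h → f g = f h) :
    groupForm χ f = ∑ c : ConjClasses G,
      χ (classRep c)⁻¹ * (centralizerSize (classRep c) : ℂ)⁻¹ * f (classRep c) := by
  let _ := Fintype.ofFinite G
  rw [groupForm_def, sum_eq_sum_conjClasses, Finset.mul_sum]
  · refine Finset.sum_congr rfl fun c _ => ?_
    have h1 : (Nat.card G : ℂ) = Nat.card c.carrier * centralizerSize (classRep c) := by
      rw [← card_conjClass_mul_centralizerSize c, Nat.cast_mul]
    have h2 : (Nat.card G : ℂ) ≠ 0 := Nat.cast_ne_zero.2 Nat.card_pos.ne'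
    rw [h1] at h2 ⊢
    have h3 := left_ne_zero_of_mul h2
    have h4 := right_ne_zero_of_mul h2
    field_simp
  · intro g h hgh
    obtain ⟨c, rfl⟩ := isConj_iff.1 hgh
    rw [hf _ _ hgh, χ.apply_eq_of_isConj (g := g⁻¹) (h := (c * g * c⁻¹)⁻¹)
      (isConj_iff.2 ⟨c, by group⟩)]

/-- The inverse of the character table of a group. -/
noncomputable def groupTableInv (G : Type*) [Group G] : Matrix (ConjClasses G) (Irr G) ℂ :=
  Matrix.of fun c χ => χ (classRep c)⁻¹ * (centralizerSize (classRep c) : ℂ)⁻¹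

/-- First orthogonality relation, summed over classes. -/
theorem groupTable_mul_inv [Fintype (ConjClasses G)] [DecidableEq (Irr G)] :
    groupTable G * groupTableInv G = 1 := by
  ext ψ χ
  rw [Matrix.mul_apply, Matrix.one_apply]
  have := groupForm_eq_sum_conjClasses χ (f := ψ) fun g h => ψ.apply_eq_of_isConj
  rw [Irr.groupForm_eq] at this
  simp only [eq_comm (a := ψ), this]
  exact Finset.sum_congr rfl fun c _ => mul_comm _ _

/-- Second orthogonality relation: the indicator function of a class is expanded in irreducible
characters. Proving it separately avoids comparing the number of irreducible characters with the
number of classes. -/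
theorem groupTableInv_mul [Fintype (Irr G)] [DecidableEq (ConjClasses G)] :
    groupTableInv G * groupTable G = 1 := by
  classical
  let _ := Fintype.ofFinite (ConjClasses G)
  ext c d
  rw [Matrix.mul_apply, Matrix.one_apply]
  have hf : ∀ g h : G, IsConj g h →
      (if c = ConjClasses.mk g then (1 : ℂ) else 0) = if c = ConjClasses.mk h then 1 else 0 := by
    intro g h hgh
    rw [ConjClasses.mk_eq_mk_iff_isConj.2 hgh]
  have h1 := eq_sum_irr (f := fun g : G => if c = ConjClasses.mk g then (1 : ℂ) else 0)
    (fun g h => hf _ _ (isConj_iff.2 ⟨h⁻¹, by group⟩)) (classRep d)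
  simp only [mk_classRep] at h1
  rw [h1]
  refine Finset.sum_congr rfl fun χ _ => ?_
  rw [groupForm_eq_sum_conjClasses χ hf]
  simp [mk_classRep, groupTable, groupTableInv]

end GroupCompleteness

end InverseSemigroup

namespace InverseSemigroup

/-! ### Conjugacy in `S`, restriction counts and the values of the characters `χ^*`. -/

section StarCharacter

variable {S : Type*} [InverseSemigroup S]

theorem dom_le_dom {s t : S} (h : s ≤ t) : dom s ≤ dom t := by
  rw [Idem.le_iff]
  change s * s⁻¹ * (t * t⁻¹) = s * s⁻¹
  rw [idem_comm (idem_dom s) (idem_dom t), ← mul_assoc]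
  congr 1
  conv_lhs => rw [le_iff_mul_ran.1 h]
  rw [← mul_assoc, mul_inv_mul]
  exact (le_iff_mul_ran.1 h).symm

/-- Left multiplication by `s⁻¹` is an injective self-map of `{y | e y = y}`, hence surjective by
finiteness. So `e = s⁻¹ y` for some `y`, and then `f e = e`. The bicyclic monoid shows that
finiteness is essential. -/
theorem IsoIdem.eq_of_le [Finite S] {e f : Idem S} (h : IsoIdem e f) (hle : f ≤ e) : f = e := by
  obtain ⟨s, rfl, rfl⟩ := h
  have hle' : (ran s : S) * dom s = ran s := Idem.le_iff.1 hle
  have hds : (dom s : S) * s⁻¹ = s⁻¹ := by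
    calc (dom s : S) * s⁻¹ = dom s * (s⁻¹ * s * s⁻¹) := by rw [inv_mul_inv]
      _ = (dom s * ran s) * s⁻¹ := (mul_assoc _ _ _).symm
      _ = s⁻¹ := by
        rw [idem_comm (dom s).2 (ran s).2, hle']; exact inv_mul_inv s
  let F : {y : S // (dom s : S) * y = y} → {y : S // (dom s : S) * y = y} :=
    fun y => ⟨s⁻¹ * y.1, by rw [← mul_assoc, hds]⟩
  have hF : Function.Injective F := by
    intro y z hyz
    have h1 : s⁻¹ * y.1 = s⁻¹ * z.1 := congrArg Subtype.val hyz
    apply Subtype.ext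
    rw [← y.2, ← z.2]
    change s * s⁻¹ * y.1 = s * s⁻¹ * z.1
    rw [mul_assoc, h1, mul_assoc]
  obtain ⟨y, hy⟩ := Finite.surjective_of_injective hF ⟨dom s, (dom s).2⟩
  have hy' : s⁻¹ * y.1 = dom s := congrArg Subtype.val hy
  refine le_antisymm hle (Idem.le_iff.2 ?_)
  rw [idem_comm (dom s).2 (ran s).2, ← hy']
  change s⁻¹ * s * (s⁻¹ * y.1) = _
  rw [← mul_assoc, inv_mul_inv]

theorem MaxSubgroup.dom_eq {e : Idem S} (g : MaxSubgroup e) : dom (g : S) = e := g.2.1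

theorem MaxSubgroup.ran_eq {e : Idem S} (g : MaxSubgroup e) : ran (g : S) = e := g.2.2

theorem MaxSubgroup.coe_mul {e : Idem S} (g h : MaxSubgroup e) :
    ((g * h : MaxSubgroup e) : S) = g * h :=
  rfl

/-- A proper restriction of `g` has its domain strictly below `e`. This makes the diagonal blocks of
`A` trivial. -/
theorem MaxSubgroup.eq_of_le [Finite S] {e : Idem S} (g : MaxSubgroup e) {t : S} (ht : t ≤ g)
    (hiso : IsoIdem e (dom t)) : t = g := by
  have h1 := hiso.eq_of_le ((dom_le_dom ht).trans_eq g.dom_eq)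
  rw [le_iff_dom_mul.1 ht]
  change (dom t : S) * g = g
  rw [h1]
  exact congrArg Subtype.val (one_mul g)

/-- Conjugacy in `S` with an element of `G_e` is conjugacy in `G_e` of the associated loop. -/
theorem isConjugate_iff {e : Idem S} (t : S) (h : MaxSubgroup e) :
    IsConjugate t h ↔
      ∃ ht : IsoIdem e (dom t), dom t = ran t ∧ IsConj h (loop (⟨t, ht⟩ : DClass e)) := by
  constructor
  · rintro ⟨e', f, ⟨h1, h2⟩, ⟨h3, -⟩, s, hs1, hs2, hst⟩
    have hf : f = e := h3.symm.trans h.dom_eq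
    subst hf
    have ht : IsoIdem f (dom t) := ⟨s⁻¹, by rw [dom_inv, hs2], by rw [ran_inv, hs1, h1]⟩
    refine ⟨ht, h1.trans h2.symm, ?_⟩
    set t' : DClass f := ⟨t, ht⟩ with ht'
    have hd : t'.dom = t'.ran := Subtype.ext (h1.trans h2.symm)
    have hps : ran (connector f t'.dom) = dom s := by
      rw [ran_connector, hs1]; exact h1
    -- The connector to `dom t` followed by the conjugator `s` closes up to an element of the group,
    -- and it conjugates `h` to the loop of `t`.
    let c : MaxSubgroup f := ⟨connector f t'.dom * s, by
      rw [dom_mul hps, ran_mul hps, dom_connector, hs2]; exact ⟨rfl, rfl⟩⟩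
    refine isConj_iff.2 ⟨c, Subtype.ext ?_⟩
    change connector f t'.dom * s * h.1 * (connector f t'.dom * s)⁻¹ =
      connector f t'.dom * t * (connector f t'.ran)⁻¹
    rw [← hd, mul_inv_eq, hst]
    simp only [mul_assoc]
  · rintro ⟨ht, hdr, hc⟩
    obtain ⟨c, hc⟩ := isConj_iff.1 hc
    set t' : DClass e := ⟨t, ht⟩ with ht'
    have hd : t'.dom = t'.ran := Subtype.ext hdr
    set p := connector e t'.dom with hp
    have hpd : dom p = e := dom_connector _
    have hpr : ran p = dom t := ran_connector _
    have hpc : ran p⁻¹ = dom (c : S) := by rw [ran_inv, hpd, c.dom_eq]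
    refine ⟨dom t, e, ⟨rfl, hdr.symm⟩, ⟨h.dom_eq, h.ran_eq⟩, p⁻¹ * c, ?_, ?_, ?_⟩
    · rw [dom_mul hpc, dom_inv, hpr]
    · rw [ran_mul hpc, c.ran_eq]
    · have h1 : (c : S) * h * (c : S)⁻¹ = p * t * p⁻¹ := by
        have := congrArg Subtype.val hc
        change (c : S) * h * (c : S)⁻¹ = p * t * (connector e t'.ran)⁻¹ at this
        rwa [← hd] at this
      have h2 : p⁻¹ * p = (dom t : S) := congrArg Subtype.val hpr
      calc t = (dom t : S) * (t * ran t) := by rw [mul_ran_self, dom_mul_self]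
        _ = (p⁻¹ * p) * (t * (p⁻¹ * p)) := by rw [← hdr, h2]
        _ = p⁻¹ * (p * t * p⁻¹) * p := by simp only [mul_assoc]
        _ = p⁻¹ * (c * h * (c : S)⁻¹) * p := by rw [h1]
        _ = p⁻¹ * c * h * (p⁻¹ * c)⁻¹ := by
          rw [mul_inv_eq, inv_inv_eq]; simp only [mul_assoc]

/-- This rests on the normalization `p_e = e`; with another choice of `p_e` the loop would only be a
conjugate of `g`. -/
theorem loop_coe {e : Idem S} (g : MaxSubgroup e) (hg : IsoIdem e (dom (g : S))) :
    loop (⟨g, hg⟩ : DClass e) = g := by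
  set t : DClass e := ⟨g, hg⟩
  have h1 : connector e t.dom = e := (exists_connector e).choose_spec.2 _ g.dom_eq
  have h2 : connector e t.ran = e := (exists_connector e).choose_spec.2 _ g.ran_eq
  apply Subtype.ext
  change connector e t.dom * g * (connector e t.ran)⁻¹ = g
  rw [h1, h2]
  exact congrArg Subtype.val (show (1 * g * 1⁻¹ : MaxSubgroup e) = g by group)

theorem isConjugate_coe_iff {e : Idem S} (g h : MaxSubgroup e) :
    IsConjugate (g : S) h ↔ IsConj h g := by
  rw [isConjugate_iff]
  constructor
  · rintro ⟨ht, -, hc⟩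
    rwa [loop_coe] at hc
  · intro hc
    refine ⟨⟨e, dom_idem e, by rw [ran_idem, g.dom_eq]⟩, g.dom_eq.trans g.ran_eq.symm, ?_⟩
    exact (loop_coe g _).symm ▸ hc

open scoped Classical in
theorem restrictionCount_eq_sum [Finite S] {e : Idem S} [Fintype (DClass e)] (h : MaxSubgroup e)
    (s : S) : (restrictionCount (h : S) s : ℂ) =
      ∑ t : DClass e, if t.1 ≤ s ∧ t.dom = t.ran ∧ IsConj h (loop t) then 1 else 0 := by
  rw [Finset.sum_boole, ← Fintype.card_subtype, ← Nat.card_eq_fintype_card, restrictionCount]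
  congr 1
  refine Nat.card_congr ⟨fun t => ⟨⟨t.1, ((isConjugate_iff _ _).1 t.2.2).1⟩, t.2.1,
      Subtype.ext ((isConjugate_iff _ _).1 t.2.2).2.1, ((isConjugate_iff _ _).1 t.2.2).2.2⟩,
    fun t => ⟨t.1.1, t.2.1, (isConjugate_iff _ _).2
      ⟨t.1.2, congrArg Subtype.val t.2.2.1, t.2.2.2⟩⟩, fun _ => rfl, fun _ => rfl⟩

theorem restrictionCount_congr_left [Finite S] {e : Idem S} {h h' : MaxSubgroup e}
    (hc : IsConj h h') (s : S) : restrictionCount (h : S) s = restrictionCount (h' : S) s := by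
  classical
  let _ := Fintype.ofFinite (DClass e)
  have : ∀ g : MaxSubgroup e, IsConj h g ↔ IsConj h' g :=
    fun g => ⟨fun k => hc.symm.trans k, fun k => hc.trans k⟩
  have h1 := restrictionCount_eq_sum h s
  simp only [this] at h1
  rw [← restrictionCount_eq_sum] at h1
  exact_mod_cast h1

theorem restrictionCount_self [Finite S] {e : Idem S} (h g : MaxSubgroup e)
    [Decidable (IsConj h g)] : restrictionCount (h : S) g = if IsConj h g then 1 else 0 := by
  have h1 : ∀ t : S, t ≤ (g : S) ∧ IsConjugate t h ↔ t = g ∧ IsConj h g := by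
    intro t
    constructor
    · rintro ⟨hle, hc⟩
      obtain rfl := g.eq_of_le hle ((isConjugate_iff _ _).1 hc).1
      exact ⟨rfl, (isConjugate_coe_iff _ _).1 hc⟩
    · rintro ⟨rfl, hc⟩
      exact ⟨le_rfl, (isConjugate_coe_iff _ _).2 hc⟩
  rw [restrictionCount]
  simp only [h1]
  split_ifs with hc <;> simp only [hc, and_true, and_false, Nat.card_unique, Nat.card_of_isEmpty]

theorem preceq_of_restrictionCount_ne_zero {e f : Idem S} {h : MaxSubgroup e} {g : MaxSubgroup f}
    (hne : restrictionCount (h : S) g ≠ 0) : Preceq e f := by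
  obtain ⟨⟨t, hle, hc⟩⟩ := (Nat.card_ne_zero.1 hne).1
  exact ⟨dom t, ((isConjugate_iff _ _).1 hc).1, (dom_le_dom hle).trans_eq g.dom_eq⟩

open scoped Classical in
-- The only nonzero block contributes to the trace only when it lies on the diagonal.
theorem trace_floorAction {V : Type*} [AddCommGroup V] [Module ℂ V] [FiniteDimensional ℂ V]
    [Finite S] {e : Idem S} (φ : Representation ℂ (MaxSubgroup e) V) (t : DClass e) :
    LinearMap.trace ℂ _ (floorAction φ t) = if t.dom = t.ran then φ.character (loop t) else 0 := by
  rw [floorAction, LinearMap.trace_comp_comm', LinearMap.comp_assoc]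
  split_ifs with h
  · rw [h, LinearMap.proj_comp_single_same, LinearMap.comp_id]
    rfl
  · rw [LinearMap.proj_comp_single_ne _ _ _ _ (Ne.symm h), LinearMap.comp_zero, map_zero]

open scoped Classical in
theorem starChar_eq_sum [Finite S] {e : Idem S} [Fintype (DClass e)] (χ : Irr (MaxSubgroup e))
    (s : S) : starChar χ s =
      ∑ t : DClass e, if t.1 ≤ s ∧ t.dom = t.ran then χ (loop t) else 0 := by
  have h1 : starRep χ.rep s = ∑ t : DClass e, if t.1 ≤ s then floorAction χ.rep t else 0 := by
    change starAction χ.rep s = _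
    rw [starAction]
    congr!
  rw [starChar, h1, map_sum]
  refine Finset.sum_congr rfl fun t _ => ?_
  rw [ite_and, apply_ite (LinearMap.trace ℂ _), map_zero, trace_floorAction, χ.character_rep]

/-- The elements `t ≤ s` are grouped by the conjugacy class of their loop, on which `χ` is constant.
Row by row this is `C = Y A`. -/
theorem starChar_eq_sum_restrictionCount [Finite S] {e : Idem S} (χ : Irr (MaxSubgroup e)) (s : S) :
    starChar χ s = ∑ c : ConjClasses (MaxSubgroup e),
      χ (classRep c) * restrictionCount ((classRep c : MaxSubgroup e) : S) s := by
  classical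
  let _ := Fintype.ofFinite (DClass e)
  simp only [restrictionCount_eq_sum, Finset.mul_sum]
  rw [Finset.sum_comm, starChar_eq_sum]
  refine Finset.sum_congr rfl fun t _ => ?_
  rw [Finset.sum_eq_single (ConjClasses.mk (loop t))]
  · have hc := isConj_classRep (loop t)
    simp only [hc, and_true, χ.apply_eq_of_isConj hc, mul_ite, mul_one, mul_zero]
  · intro c _ hc
    rw [if_neg, mul_zero]
    rintro ⟨-, -, h⟩
    exact hc (by rw [← mk_classRep c]; exact ConjClasses.mk_eq_mk_iff_isConj.2 h)
  · simp

theorem trace_conj_eq {V : Type*} [AddCommGroup V] [Module ℂ V] (ρ : S →ₙ* Module.End ℂ V)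
    {e : Idem S} {g h : MaxSubgroup e} (hc : IsConj g h) :
    LinearMap.trace ℂ V (ρ g) = LinearMap.trace ℂ V (ρ h) := by
  obtain ⟨c, rfl⟩ := isConj_iff.1 hc
  rw [MaxSubgroup.coe_mul, map_mul, LinearMap.trace_mul_comm, ← map_mul, ← MaxSubgroup.coe_mul,
    inv_mul_cancel_left]

/-- Inverting the group character table recovers the counts from the values of the `χ^*`, which are
traces and so are invariant under conjugation of `g`. -/
theorem restrictionCount_congr_right [Finite S] {e f : Idem S} (h : MaxSubgroup e)
    {g g' : MaxSubgroup f} (hc : IsConj g g') :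
    restrictionCount (h : S) (g : S) = restrictionCount (h : S) (g' : S) := by
  have h1 : ∀ s : S, (groupTable (MaxSubgroup e)).mulVec
      (fun c => (restrictionCount ((classRep c : MaxSubgroup e) : S) s : ℂ)) = fun χ => starChar χ s :=
    fun s => funext fun χ => (starChar_eq_sum_restrictionCount χ s).symm
  have h2 : (fun c => (restrictionCount ((classRep c : MaxSubgroup e) : S) g : ℂ)) =
      fun c : ConjClasses (MaxSubgroup e) => (restrictionCount ((classRep c : MaxSubgroup e) : S) g' : ℂ) := by
    rw [← Matrix.one_mulVec (fun c => (restrictionCount ((classRep c : MaxSubgroup e) : S) (g : S) : ℂ)),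
      ← Matrix.one_mulVec (fun c => (restrictionCount ((classRep c : MaxSubgroup e) : S) (g' : S) : ℂ)),
      ← groupTableInv_mul, ← Matrix.mulVec_mulVec, ← Matrix.mulVec_mulVec, h1, h1]
    congr 1
    exact funext fun χ => trace_conj_eq _ hc
  have h3 := congrFun h2 (ConjClasses.mk h)
  rw [restrictionCount_congr_left (isConj_classRep h),
    restrictionCount_congr_left (isConj_classRep h)] at h3
  exact_mod_cast h3

end StarCharacter

end InverseSemigroup

namespace InverseSemigroup

/-! ### Möbius inversion over the idempotents and the decomposition of characters of `S`. -/

section Floor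

open scoped Classical

variable {S : Type*} [InverseSemigroup S] [Finite S]

/-- A `Fintype` structure on the idempotents of a finite inverse semigroup. -/
@[reducible] noncomputable def idemFintype (S : Type*) [InverseSemigroup S] [Finite S] :
    Fintype (Idem S) :=
  Fintype.ofFinite _

attribute [local instance] idemFintype

/-- The Möbius function of the poset of idempotents. -/
noncomputable def moebius (f e : Idem S) : ℂ :=
  letI : LocallyFiniteOrder (Idem S) := Fintype.toLocallyFiniteOrder
  IncidenceAlgebra.mu ℂ f e

theorem sum_moebius (f e : Idem S) :
    ∑ h : Idem S with f ≤ h ∧ h ≤ e, moebius f h = if f = e then 1 else 0 := by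
  let _ : LocallyFiniteOrder (Idem S) := Fintype.toLocallyFiniteOrder
  rw [← IncidenceAlgebra.sum_Icc_mu_right (𝕜 := ℂ) f e]
  refine Finset.sum_congr ?_ fun _ _ => rfl
  ext h
  simp

theorem semigroupForm_eq_sum {e : Idem S} (χ : MaxSubgroup e → ℂ) (θ : S → ℂ) :
    semigroupForm χ θ = ∑ f : Idem S with f ≤ e,
      moebius f e * groupForm χ (fun g => θ ((f : S) * (g : S))) := by
  rw [Finset.sum_filter]
  exact Finset.sum_congr rfl fun f _ => by rw [mul_comm]; rfl

variable {V : Type*} [AddCommGroup V] [Module ℂ V] (ρ : S →ₙ* Module.End ℂ V)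

/-- The image under `ρ` of the primitive idempotent `∑_{f ≤ e} μ(f, e) f` of the algebra of the
semilattice of idempotents. -/
noncomputable def floorIdem (e : Idem S) : Module.End ℂ V :=
  ∑ f : Idem S with f ≤ e, moebius f e • ρ f

/-- Möbius inversion: after exchanging the sums, the coefficient of `ρ g` is the sum of `μ(g, ·)`
over the interval from `g` to `e`. -/
theorem sum_floorIdem (e : Idem S) : ∑ f : Idem S with f ≤ e, floorIdem ρ f = ρ e := by
  have h1 : ∀ f : Idem S, f ∈ Finset.univ.filter (· ≤ e) → floorIdem ρ f =
      ∑ g : Idem S, if g ≤ f then moebius g f • ρ g else 0 := by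
    intro f _
    rw [floorIdem, Finset.sum_filter]
  rw [Finset.sum_congr rfl h1, Finset.sum_comm]
  have h2 : ∀ g : Idem S, (∑ f : Idem S with f ≤ e, if g ≤ f then moebius g f • ρ g else 0) =
      if g = e then ρ g else 0 := by
    intro g
    rw [← Finset.sum_filter, Finset.filter_filter, ← Finset.sum_smul]
    simp only [and_comm]
    rw [sum_moebius, ite_smul, one_smul, zero_smul]
  rw [Finset.sum_congr rfl fun g _ => h2 g, Finset.sum_ite_eq', if_pos (Finset.mem_univ _)]

theorem floorIdem_eq_sub (e : Idem S) :
    floorIdem ρ e = ρ e - ∑ f : Idem S with f < e, floorIdem ρ f := by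
  rw [eq_sub_iff_add_eq, ← sum_floorIdem ρ e]
  have : Finset.univ.filter (fun f : Idem S => f ≤ e) =
      insert e (Finset.univ.filter (fun f : Idem S => f < e)) := by
    ext f
    simp [le_iff_eq_or_lt]
  rw [this, Finset.sum_insert (by simp)]

theorem map_mul_floorIdem_of_le {e h : Idem S} (hle : e ≤ h) :
    ρ h * floorIdem ρ e = floorIdem ρ e := by
  rw [floorIdem, Finset.mul_sum]
  refine Finset.sum_congr rfl fun f hf => ?_
  rw [mul_smul_comm, ← map_mul, idem_comm h.2 f.2,
    Idem.le_iff.1 ((Finset.mem_filter.1 hf).2.trans hle)]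

theorem floorIdem_mul_map_comm (e h : Idem S) :
    floorIdem ρ e * ρ h = ρ h * floorIdem ρ e := by
  rw [floorIdem, Finset.mul_sum, Finset.sum_mul]
  refine Finset.sum_congr rfl fun f _ => ?_
  rw [mul_smul_comm, smul_mul_assoc, ← map_mul, ← map_mul, idem_comm h.2 f.2]

theorem floorIdem_comm (e f : Idem S) :
    floorIdem ρ e * floorIdem ρ f = floorIdem ρ f * floorIdem ρ e := by
  conv_lhs => rw [floorIdem.eq_def ρ f]
  conv_rhs => rw [floorIdem.eq_def ρ f]
  rw [Finset.mul_sum, Finset.sum_mul]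
  refine Finset.sum_congr rfl fun g _ => ?_
  rw [mul_smul_comm, smul_mul_assoc, floorIdem_mul_map_comm]

/-- Induction on `e`. Since `floorIdem ρ e` absorbs `ρ e`, `h` may be replaced by `k = h e < e`.
Expand `floorIdem ρ e` as `ρ e` minus the terms with `f < e`: by induction `ρ k` kills the terms
with `f` not below `k`, and it fixes the others, which add up to `ρ k`. What remains is `ρ k - ρ k`.
-/
theorem map_mul_floorIdem_of_not_le {e : Idem S} :
    ∀ h : Idem S, ¬ e ≤ h → ρ h * floorIdem ρ e = 0 := by
  induction e using WellFoundedLT.induction with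
  | ind e ih =>
    intro h hle
    let k : Idem S := ⟨h * e, idem_mul_aux h.2 e.2⟩
    have hke : k ≤ e := Idem.le_iff.2 (by
      change (h : S) * e * e = h * e
      rw [mul_assoc, e.2])
    have hne : k ≠ e := fun hk => hle (Idem.le_iff.2 (by
      rw [idem_comm e.2 h.2]; exact congrArg Subtype.val hk))
    have h1 : ρ h * floorIdem ρ e = ρ k * floorIdem ρ e := by
      conv_lhs => rw [← map_mul_floorIdem_of_le ρ (le_refl e), ← mul_assoc, ← map_mul]
    have h2 : ρ k * ρ e = ρ k := by rw [← map_mul, Idem.le_iff.1 hke]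
    rw [h1, floorIdem_eq_sub, mul_sub, h2, Finset.mul_sum, sub_eq_zero]
    refine (sum_floorIdem ρ k).symm.trans ?_
    have h3 : Finset.univ.filter (fun f : Idem S => f ≤ k) =
        (Finset.univ.filter (fun f : Idem S => f < e)).filter (fun f => f ≤ k) := by
      ext f
      simp only [Finset.mem_filter, Finset.mem_univ, true_and]
      exact ⟨fun hf => ⟨hf.trans_lt (lt_of_le_of_ne hke hne), hf⟩, fun hf => hf.2⟩
    rw [h3, Finset.sum_filter]
    refine Finset.sum_congr rfl fun f hf => ?_
    split_ifs with hfk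
    · exact (map_mul_floorIdem_of_le ρ hfk).symm
    · exact (ih f (Finset.mem_filter.1 hf).2 k hfk).symm

/-- Of two distinct idempotents at least one is not below the other, so one factor absorbs an
idempotent that annihilates the other factor. -/
theorem floorIdem_mul_of_ne {e f : Idem S} (hne : e ≠ f) :
    floorIdem ρ e * floorIdem ρ f = 0 := by
  have key : ∀ e f : Idem S, ¬ f ≤ e → floorIdem ρ e * floorIdem ρ f = 0 := by
    intro e f h
    rw [← map_mul_floorIdem_of_le ρ (le_refl e), ← floorIdem_mul_map_comm, mul_assoc,
      map_mul_floorIdem_of_not_le ρ e h, mul_zero]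
  by_cases h : f ≤ e
  · rw [floorIdem_comm]
    exact key f e fun h' => hne (le_antisymm h' h)
  · exact key e f h

theorem floorIdem_mul_self (e : Idem S) : floorIdem ρ e * floorIdem ρ e = floorIdem ρ e := by
  nth_rewrite 1 [floorIdem_eq_sub ρ e]
  rw [sub_mul, map_mul_floorIdem_of_le ρ le_rfl, Finset.sum_mul, Finset.sum_eq_zero, sub_zero]
  intro f hf
  exact floorIdem_mul_of_ne ρ (Finset.mem_filter.1 hf).2.ne

/-- The idempotent `s f s⁻¹`. -/
def conjIdem (s : S) (f : Idem S) : Idem S :=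
  ⟨s * f * s⁻¹, by
    calc s * f * s⁻¹ * (s * f * s⁻¹) = s * (f * (s⁻¹ * s)) * f * s⁻¹ := by simp only [mul_assoc]
      _ = s * ((s⁻¹ * s) * f) * f * s⁻¹ := by rw [idem_comm f.2 (idem_ran s)]
      _ = (s * (s⁻¹ * s)) * (f * f) * s⁻¹ := by simp only [mul_assoc]
      _ = s * f * s⁻¹ := by rw [mul_inv_mul', f.2]⟩

omit [Finite S] in
theorem conjIdem_mul (s : S) (f : Idem S) : (conjIdem s f : S) * s = s * f := by
  calc s * f * s⁻¹ * s = s * (f * (s⁻¹ * s)) := by simp only [mul_assoc]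
    _ = s * ((s⁻¹ * s) * f) := by rw [idem_comm f.2 (idem_ran s)]
    _ = s * f := by rw [← mul_assoc, mul_inv_mul']

omit [Finite S] in
theorem ran_le_of_dom_le_conjIdem {s : S} {f : Idem S} (h : dom s ≤ conjIdem s f) :
    ran s ≤ f := by
  rw [Idem.le_iff] at h ⊢
  have h1 : s = s * f := by
    calc s = dom s * s := (dom_mul_self s).symm
      _ = dom s * conjIdem s f * s := by rw [h]
      _ = dom s * (s * f) := by rw [mul_assoc, conjIdem_mul]
      _ = s * f := by rw [← mul_assoc, dom_mul_self]
  change s⁻¹ * s * f = s⁻¹ * s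
  rw [mul_assoc, ← h1]

omit [Finite S] in
theorem mul_conjIdem_inv (s : S) (f : Idem S) : s * (conjIdem s⁻¹ f : S) = f * s := by
  change s * (s⁻¹ * f * s⁻¹⁻¹) = f * s
  rw [inv_inv_eq]
  calc s * (s⁻¹ * f * s) = ((s * s⁻¹) * f) * s := by simp only [mul_assoc]
    _ = (f * (s * s⁻¹)) * s := by rw [idem_comm f.2 (idem_dom s)]
    _ = f * s := by rw [mul_assoc, mul_inv_mul]

/-- The elements of the semigroup intertwine the primitive idempotents of their domain and
range. -/
theorem map_mul_floorIdem_ran (s : S) :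
    ρ s * floorIdem ρ (ran s) = floorIdem ρ (dom s) * ρ s := by
  -- Both sides equal the product with `floorIdem` on either side of `ρ s`. Here `ρ (dom s)` is
  -- split over `f ≤ dom s`. For `f ≠ dom s`, moving `f` across `s` turns it into `s⁻¹ f s`, which
  -- is not above `ran s` and so annihilates `floorIdem ρ (ran s)`.
  have h1 : ρ s * floorIdem ρ (ran s) = floorIdem ρ (dom s) * (ρ s * floorIdem ρ (ran s)) := by
    have h0 : ρ s = ρ (dom s) * ρ s := by rw [← map_mul, dom_mul_self]
    conv_lhs => rw [h0, mul_assoc, ← sum_floorIdem ρ (dom s), Finset.sum_mul]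
    refine Finset.sum_eq_single (dom s) ?_ (fun h => absurd (by simp) h)
    intro f hf hne
    rw [Finset.mem_filter] at hf
    have h2 : ¬ ran s ≤ conjIdem s⁻¹ f := by
      intro h
      rw [← dom_inv] at h
      have := ran_le_of_dom_le_conjIdem h
      rw [ran_inv] at this
      exact hne (le_antisymm hf.2 this)
    rw [← map_mul_floorIdem_of_le ρ (le_refl f), ← floorIdem_mul_map_comm, mul_assoc,
      ← mul_assoc (ρ f), ← map_mul, ← mul_conjIdem_inv, map_mul, mul_assoc,
      map_mul_floorIdem_of_not_le ρ _ h2, mul_zero, mul_zero]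
  have h3 : floorIdem ρ (dom s) * ρ s = floorIdem ρ (dom s) * ρ s * floorIdem ρ (ran s) := by
    have h0 : ρ s = ρ s * ρ (ran s) := by rw [← map_mul, mul_ran_self]
    conv_lhs => rw [h0, ← mul_assoc, ← sum_floorIdem ρ (ran s), Finset.mul_sum]
    refine Finset.sum_eq_single (ran s) ?_ (fun h => absurd (by simp) h)
    intro f hf hne
    rw [Finset.mem_filter] at hf
    have h2 : ¬ dom s ≤ conjIdem s f := fun h =>
      hne (le_antisymm hf.2 (ran_le_of_dom_le_conjIdem h))
    rw [← map_mul_floorIdem_of_le ρ (le_refl f), mul_assoc, ← mul_assoc (ρ s), ← map_mul,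
      ← conjIdem_mul, map_mul, ← mul_assoc, ← mul_assoc, floorIdem_mul_map_comm,
      map_mul_floorIdem_of_not_le ρ _ h2, zero_mul, zero_mul]
  rw [h1, ← mul_assoc, ← h3]

/-- The trace of the Möbius transform of `t`. -/
noncomputable def floorTrace (t : S) : ℂ := LinearMap.trace ℂ V (floorIdem ρ (dom t) * ρ t)

/-- The intertwining relation puts the idempotent at `ran t` on the right, and cyclicity of the
trace brings it next to the orthogonal one at `dom t`. -/
theorem floorTrace_eq_zero {t : S} (h : dom t ≠ ran t) : floorTrace ρ t = 0 := by
  rw [floorTrace, ← floorIdem_mul_self, mul_assoc, ← map_mul_floorIdem_ran,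
    LinearMap.trace_mul_comm, mul_assoc, floorIdem_mul_of_ne ρ h.symm, mul_zero, map_zero]

/-- The loop is `p t p⁻¹`. Cyclicity of the trace brings `p⁻¹` round to meet `p`, and `p⁻¹ p = ran
t` is absorbed by `t`. -/
theorem floorTrace_loop {e : Idem S} (t : DClass e) (h : t.dom = t.ran) :
    floorTrace ρ (loop t : S) = floorTrace ρ t.1 := by
  set p := connector e t.dom with hp
  have hpd : dom p = e := dom_connector _
  have hpr : ran p = InverseSemigroup.dom t.1 := ran_connector _
  have h1 : ((loop t : MaxSubgroup e) : S) = p * t.1 * p⁻¹ := by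
    change p * t.1 * (connector e t.ran)⁻¹ = _
    rw [← h]
  have h2 : t.1 * (p⁻¹ * p) = t.1 := by
    have h3 : p⁻¹ * p = (InverseSemigroup.ran t.1 : S) := by
      rw [← show InverseSemigroup.dom t.1 = InverseSemigroup.ran t.1 from congrArg Subtype.val h,
        ← hpr]
      rfl
    rw [h3, mul_ran_self]
  have h4 : dom (p * t.1 * p⁻¹) = dom p := by rw [← h1, (loop t).dom_eq, hpd]
  rw [floorTrace, h1, h4, map_mul ρ, map_mul ρ, ← mul_assoc, ← mul_assoc,
    ← map_mul_floorIdem_ran, mul_assoc, mul_assoc, LinearMap.trace_mul_comm, mul_assoc, mul_assoc,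
    ← map_mul ρ, ← map_mul ρ, h2, hpr, floorTrace]

/-- The elements below `s` are the `f s` with `f ≤ dom s`, each determined by its domain `f`.
Splitting `ρ (dom s)` into the `floorIdem ρ f` therefore splits the trace over them. -/
theorem trace_eq_sum_floorTrace [Fintype S] (s : S) :
    LinearMap.trace ℂ V (ρ s) = ∑ t : S with t ≤ s, floorTrace ρ t := by
  conv_lhs => rw [← dom_mul_self s, map_mul, ← sum_floorIdem, Finset.sum_mul, map_sum]
  have hdom : ∀ f : Idem S, f ≤ dom s → dom ((f : S) * s) = f := by
    intro f hf
    apply Subtype.ext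
    change f * s * (f * s)⁻¹ = (f : S)
    rw [mul_inv_eq, inv_eq_of_idem f.2]
    calc (f : S) * s * (s⁻¹ * f) = f * (s * s⁻¹) * f := by simp only [mul_assoc]
      _ = f := by rw [show (f : S) * (s * s⁻¹) = f from Idem.le_iff.1 hf, f.2]
  refine Finset.sum_bij' (fun f _ => (f : S) * s) (fun t _ => dom t) ?_ ?_ ?_ ?_ ?_
  · exact fun f _ => Finset.mem_filter.2 ⟨Finset.mem_univ _, f, f.2, rfl⟩
  · exact fun t ht => Finset.mem_filter.2 ⟨Finset.mem_univ _, dom_le_dom (Finset.mem_filter.1 ht).2⟩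
  · exact fun f hf => hdom f (Finset.mem_filter.1 hf).2
  · exact fun t ht => (le_iff_dom_mul.1 (Finset.mem_filter.1 ht).2).symm
  · intro f hf
    rw [floorTrace, hdom f (Finset.mem_filter.1 hf).2, map_mul ρ, ← mul_assoc,
      floorIdem_mul_map_comm, map_mul_floorIdem_of_le ρ le_rfl]

/-- The representation of `G_e` on the range of the primitive idempotent at `e`. -/
noncomputable def floorRep (e : Idem S) :
    Representation ℂ (MaxSubgroup e) (LinearMap.range (floorIdem ρ e)) where
  toFun g := (ρ g).restrict (by
    rintro _ ⟨v, rfl⟩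
    refine ⟨ρ g v, ?_⟩
    have := map_mul_floorIdem_ran ρ (g : S)
    rw [g.dom_eq, g.ran_eq] at this
    exact (LinearMap.congr_fun this v).symm)
  map_one' := by
    apply LinearMap.ext
    rintro ⟨_, v, rfl⟩
    exact Subtype.ext (LinearMap.congr_fun (map_mul_floorIdem_of_le ρ (le_refl e)) v)
  map_mul' g h := by
    apply LinearMap.ext
    intro v
    exact Subtype.ext (LinearMap.congr_fun (map_mul ρ (g : S) h) v.1)

theorem character_floorRep [FiniteDimensional ℂ V] (e : Idem S) (g : MaxSubgroup e) :
    (floorRep ρ e).character g = floorTrace ρ (g : S) := by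
  rw [floorTrace, g.dom_eq, ← LinearMap.trace_restrict_eq_of_forall_mem
    (LinearMap.range (floorIdem ρ e)) (floorIdem ρ e * ρ g) fun v => ⟨ρ g v, rfl⟩]
  rw [Representation.character]
  congr 1
  apply LinearMap.ext
  rintro ⟨_, v, rfl⟩
  apply Subtype.ext
  change ρ g (floorIdem ρ e v) = floorIdem ρ e (ρ g (floorIdem ρ e v))
  have h1 := map_mul_floorIdem_ran ρ (g : S)
  rw [g.dom_eq, g.ran_eq] at h1
  have h2 : ρ g * floorIdem ρ e = floorIdem ρ e * (ρ g * floorIdem ρ e) := by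
    rw [h1, ← mul_assoc, floorIdem_mul_self]
  exact LinearMap.congr_fun h2 v

/-- The Möbius sum defining the form is the one defining `floorIdem`, moved outside the trace. -/
theorem semigroupForm_trace {e : Idem S} (χ : MaxSubgroup e → ℂ) :
    semigroupForm χ (fun s => LinearMap.trace ℂ V (ρ s)) =
      groupForm χ (fun g => floorTrace ρ (g : S)) := by
  rw [semigroupForm_eq_sum, ← groupForm_sum_right]
  congr 1
  funext g
  rw [floorTrace, g.dom_eq, floorIdem, Finset.sum_mul, map_sum]
  exact Finset.sum_congr rfl fun f _ => by rw [smul_mul_assoc, map_smul, ← map_mul, smul_eq_mul]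

omit [Finite S] in
/-- The `𝒟`-classes of a transversal partition the semigroup. -/
theorem IsOrderedTransversal.bijective_sigma {n : ℕ} {e : Fin n → Idem S}
    (he : IsOrderedTransversal e) :
    Function.Bijective (fun x : Σ i, DClass (e i) => x.2.1) := by
  constructor
  · rintro ⟨i, s, hs⟩ ⟨j, t, ht⟩ h
    obtain rfl : s = t := h
    obtain ⟨p, hp1, hp2⟩ := hs
    obtain ⟨q, hq1, hq2⟩ := ht
    have hpq : ran p = dom q⁻¹ := by rw [dom_inv, hp2, hq2]
    obtain rfl := he.eq_of_iso i j ⟨p * q⁻¹, by rw [dom_mul hpq, hp1],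
      by rw [ran_mul hpq, ran_inv, hq1]⟩
    rfl
  · intro s
    obtain ⟨i, hi⟩ := he.exists_iso (dom s)
    exact ⟨⟨i, s, hi⟩, rfl⟩

/-- Every character of `S` is a combination of the characters `χ^*`, with multiplicities given by
the form on `S`. -/
theorem IsCharacter.exists_decomposition {n : ℕ} {e : Fin n → Idem S}
    (he : IsOrderedTransversal e) {θ : S → ℂ} (hθ : IsCharacter θ) :
    ∃ m : IrrLabel e → ℕ, (∀ s : S, θ s = ∑ ψ : IrrLabel e, (m ψ : ℂ) * starChar ψ.2 s) ∧
      ∀ (i : Fin n) (χ : Irr (MaxSubgroup (e i))), semigroupForm χ θ = (m ⟨i, χ⟩ : ℂ) := by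
  obtain ⟨d, ρ, hρ⟩ := hθ
  obtain rfl : θ = fun s => LinearMap.trace ℂ _ (ρ s) := funext hρ
  have hchar : ∀ i, (fun g : MaxSubgroup (e i) => floorTrace ρ (g : S)) =
      (floorRep ρ (e i)).character := fun i => funext fun g => (character_floorRep ρ _ g).symm
  choose m hm using fun x : IrrLabel e => groupForm_irr_character (floorRep ρ (e x.1)) x.2
  refine ⟨m, fun s => ?_, fun i χ => ?_⟩
  · let _ := Fintype.ofFinite S
    let _ : ∀ i, Fintype (DClass (e i)) := fun i => Fintype.ofFinite _
    have h1 : ∀ i (g : MaxSubgroup (e i)), floorTrace ρ (g : S) =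
        ∑ χ : Irr (MaxSubgroup (e i)), (m ⟨i, χ⟩ : ℂ) * χ g := by
      intro i g
      rw [← character_floorRep, eq_sum_irr (f := (floorRep ρ (e i)).character)
        fun g h => Representation.char_conj _ g h]
      exact Finset.sum_congr rfl fun χ _ => by rw [hm ⟨i, χ⟩]
    change LinearMap.trace ℂ _ (ρ s) = _
    -- The elements `t` are sorted by `𝒟`-class, so that each trace can be moved to the group at `e
    -- i` and compared with `starChar_eq_sum` term by term.
    rw [trace_eq_sum_floorTrace, Finset.sum_filter,
      ← (Equiv.ofBijective _ he.bijective_sigma).sum_comp, Fintype.sum_sigma, Fintype.sum_sigma]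
    refine Finset.sum_congr rfl fun i _ => ?_
    simp only [starChar_eq_sum, Finset.mul_sum]
    rw [Finset.sum_comm]
    refine Finset.sum_congr rfl fun t _ => ?_
    change (if t.1 ≤ s then floorTrace ρ t.1 else 0) = _
    by_cases hts : t.1 ≤ s
    · by_cases hd : t.dom = t.ran
      · simp only [hts, hd, and_self, if_true]
        rw [← floorTrace_loop ρ t hd, h1]
      · simp only [hts, hd, and_false, if_true, if_false, mul_zero, Finset.sum_const_zero]
        exact floorTrace_eq_zero ρ fun h => hd (Subtype.ext h)
    · simp [hts]
  · rw [semigroupForm_trace, hchar]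
    exact hm ⟨i, χ⟩

end Floor

end InverseSemigroup

namespace InverseSemigroup

/-! ### Matrix identities among `C`, `Y`, `A` and `B`, and the multiplicity formulas. -/

section Tables

variable {S : Type*} [InverseSemigroup S] {n : ℕ}

theorem blockDiagonal_mul_apply {L R : Fin n → Type*} {X : Type*} [∀ i, Fintype (R i)]
    (D : ∀ i, Matrix (L i) (R i) ℂ) (M : Matrix (Σ i, R i) X ℂ) (i : Fin n) (a : L i) (x : X) :
    (Matrix.blockDiagonal' D * M) ⟨i, a⟩ x = ∑ c, D i a c * M ⟨i, c⟩ x := by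
  rw [Matrix.mul_apply, Fintype.sum_sigma, Finset.sum_eq_single i]
  · simp only [Matrix.blockDiagonal'_apply_eq]
  · intro j _ hj
    exact Finset.sum_eq_zero fun c _ => by
      rw [Matrix.blockDiagonal'_apply_ne _ _ _ hj.symm, zero_mul]
  · simp

theorem mul_blockDiagonal_apply {L R : Fin n → Type*} {X : Type*} [∀ i, Fintype (L i)]
    (D : ∀ i, Matrix (L i) (R i) ℂ) (M : Matrix X (Σ i, L i) ℂ) (i : Fin n) (b : R i) (x : X) :
    (M * Matrix.blockDiagonal' D) x ⟨i, b⟩ = ∑ c, M x ⟨i, c⟩ * D i c b := by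
  rw [Matrix.mul_apply, Fintype.sum_sigma, Finset.sum_eq_single i]
  · simp only [Matrix.blockDiagonal'_apply_eq]
  · intro j _ hj
    exact Finset.sum_eq_zero fun c _ => by
      rw [Matrix.blockDiagonal'_apply_ne _ _ _ hj, mul_zero]
  · simp

theorem IsBlockUpperUnitriangular.isUnit {L : Fin n → Type*} [∀ i, Fintype (L i)]
    [∀ i, DecidableEq (L i)] {M : Matrix (Σ i, L i) (Σ i, L i) ℂ}
    (hM : IsBlockUpperUnitriangular M) : IsUnit M := by
  rw [Matrix.isUnit_iff_isUnit_det]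
  have hb : M.BlockTriangular Sigma.fst := by
    rintro ⟨i, a⟩ ⟨j, b⟩ h
    exact hM.below i j a b h
  rw [hb.det, Finset.prod_eq_one]
  · exact isUnit_one
  · intro k _
    have : M.toSquareBlock Sigma.fst k = 1 := by
      ext ⟨⟨i, a⟩, hi⟩ ⟨⟨j, b⟩, hj⟩
      obtain rfl : i = k := hi
      obtain rfl : j = i := hj
      rw [Matrix.toSquareBlock_def, Matrix.of_apply, Matrix.one_apply]
      by_cases hab : a = b
      · subst hab
        rw [if_pos rfl]
        exact hM.diag_same j a
      · rw [if_neg fun h => hab (by simpa using h)]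
        exact hM.diag_ne j a b hab
    rw [this, Matrix.det_one]

variable (e : Fin n → Idem S)

/-- The block diagonal inverse of the matrix of the group character tables. -/
noncomputable def blockTableInv : Matrix (ClassLabel e) (IrrLabel e) ℂ :=
  Matrix.blockDiagonal' fun i => groupTableInv (MaxSubgroup (e i))

/-- The matrix of the numbers of restrictions of `g` that are conjugate to `h`. -/
noncomputable def restrictionMatrix : Matrix (ClassLabel e) (ClassLabel e) ℂ :=
  Matrix.of fun c d => (restrictionCount ((classRep c.2 : MaxSubgroup (e c.1)) : S)
    ((classRep d.2 : MaxSubgroup (e d.1)) : S) : ℂ)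

variable [Finite S]

theorem blockTable_mul_inv : blockTable e * blockTableInv e = 1 := by
  rw [blockTable, blockTableInv, ← Matrix.blockDiagonal'_mul]
  simp only [groupTable_mul_inv]
  exact Matrix.blockDiagonal'_one

theorem blockTableInv_mul : blockTableInv e * blockTable e = 1 := by
  rw [blockTable, blockTableInv, ← Matrix.blockDiagonal'_mul]
  simp only [groupTableInv_mul]
  exact Matrix.blockDiagonal'_one

theorem charTable_eq_mul_restrictionMatrix :
    charTable e = blockTable e * restrictionMatrix e := by
  ext ⟨i, χ⟩ d
  rw [blockTable, blockDiagonal_mul_apply]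
  exact starChar_eq_sum_restrictionCount χ _

theorem restrictionMatrix_mk (i j : Fin n) (h : MaxSubgroup (e i)) (g : MaxSubgroup (e j)) :
    restrictionMatrix e ⟨i, ConjClasses.mk h⟩ ⟨j, ConjClasses.mk g⟩ =
      (restrictionCount (h : S) (g : S) : ℂ) := by
  rw [← restrictionCount_congr_left (isConj_classRep h),
    ← restrictionCount_congr_right _ (isConj_classRep g)]
  rfl

variable {e}

/-- A nonzero entry yields an idempotent below `e j` isomorphic to `e i`, so the numbering forces `i
≤ j`. Within one group the only restriction that counts is the element itself. -/
theorem IsOrderedTransversal.restrictionMatrix_unitriangular (he : IsOrderedTransversal e) :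
    IsBlockUpperUnitriangular (restrictionMatrix e) := by
  classical
  have hdiag : ∀ (i : Fin n) (a b : ConjClasses (MaxSubgroup (e i))),
      restrictionMatrix e ⟨i, a⟩ ⟨i, b⟩ = if a = b then 1 else 0 := by
    intro i a b
    have h1 := restrictionCount_self (classRep a) (classRep b)
    rw [← ConjClasses.mk_eq_mk_iff_isConj, mk_classRep, mk_classRep] at h1
    exact (congrArg Nat.cast h1).trans (by push_cast; rfl)
  refine ⟨fun i j a b hji => ?_, fun i a => by rw [hdiag, if_pos rfl],
    fun i a b hab => by rw [hdiag, if_neg hab]⟩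
  by_contra hne
  have h1 : restrictionCount ((classRep a : MaxSubgroup (e i)) : S)
      ((classRep b : MaxSubgroup (e j)) : S) ≠ 0 := fun h => hne (by
    change ((restrictionCount _ _ : ℕ) : ℂ) = 0
    rw [h, Nat.cast_zero])
  exact (he.le_of_preceq i j (preceq_of_restrictionCount_ne_zero h1)).not_gt hji

theorem IsOrderedTransversal.charTable_below (he : IsOrderedTransversal e) {i j : Fin n}
    (χ : Irr (MaxSubgroup (e i))) (c : ConjClasses (MaxSubgroup (e j))) (h : j < i) :
    charTable e ⟨i, χ⟩ ⟨j, c⟩ = 0 := by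
  rw [charTable_eq_mul_restrictionMatrix, blockTable, blockDiagonal_mul_apply]
  exact Finset.sum_eq_zero fun d _ => by
    rw [he.restrictionMatrix_unitriangular.below i j d c h, mul_zero]

theorem IsOrderedTransversal.charTable_diag (he : IsOrderedTransversal e) (i : Fin n)
    (χ : Irr (MaxSubgroup (e i))) (c : ConjClasses (MaxSubgroup (e i))) :
    charTable e ⟨i, χ⟩ ⟨i, c⟩ = groupTable (MaxSubgroup (e i)) χ c := by
  rw [charTable_eq_mul_restrictionMatrix, blockTable, blockDiagonal_mul_apply,
    Finset.sum_eq_single c]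
  · rw [he.restrictionMatrix_unitriangular.diag_same, mul_one]
  · intro d _ hd
    rw [he.restrictionMatrix_unitriangular.diag_ne i d c hd, mul_zero]
  · simp

theorem IsOrderedTransversal.charTable_mul_inv_unitriangular (he : IsOrderedTransversal e) :
    IsBlockUpperUnitriangular (charTable e * blockTableInv e) := by
  have hdiag : ∀ (i : Fin n) (a b : Irr (MaxSubgroup (e i))),
      (charTable e * blockTableInv e) ⟨i, a⟩ ⟨i, b⟩ = if a = b then 1 else 0 := by
    intro i a b
    rw [blockTableInv, mul_blockDiagonal_apply]
    simp only [he.charTable_diag]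
    rw [← Matrix.mul_apply, groupTable_mul_inv, Matrix.one_apply]
  refine ⟨fun i j a b hji => ?_, fun i a => by rw [hdiag, if_pos rfl],
    fun i a b hab => by rw [hdiag, if_neg hab]⟩
  rw [blockTableInv, mul_blockDiagonal_apply]
  exact Finset.sum_eq_zero fun c _ => by rw [he.charTable_below a c hji, zero_mul]

open Matrix in
/-- Multiplicities from the values on class representatives, through the inverse of the matrix of
restriction counts. -/
theorem multiplicity_eq_sum_restrictionMatrix {A : Matrix (ClassLabel e) (ClassLabel e) ℂ}
    (hA : IsUnit A) (hC : charTable e = blockTable e * A) {θ : S → ℂ} {m : IrrLabel e → ℂ}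
    (hm : ∀ s, θ s = ∑ ψ : IrrLabel e, m ψ * starChar ψ.2 s) (i : Fin n)
    (χ : Irr (MaxSubgroup (e i))) :
    m ⟨i, χ⟩ = ∑ c : ConjClasses (MaxSubgroup (e i)),
      χ ((classRep c)⁻¹) * (centralizerSize (classRep c) : ℂ)⁻¹ *
        ∑ d : ClassLabel e, A⁻¹ d ⟨i, c⟩ * θ (classRep d.2 : MaxSubgroup (e d.1)) := by
  let v : ClassLabel e → ℂ := fun d => θ (classRep d.2 : MaxSubgroup (e d.1))
  have hv : v = m ᵥ* charTable e := funext fun d => hm _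
  have h1 : m = (v ᵥ* A⁻¹) ᵥ* blockTableInv e := by
    rw [hv, vecMul_vecMul, vecMul_vecMul, hC, Matrix.mul_assoc,
      Matrix.mul_nonsing_inv_cancel_left _ _ ((Matrix.isUnit_iff_isUnit_det _).1 hA),
      blockTable_mul_inv, vecMul_one]
  -- The row vector is viewed as a one-row matrix so that `mul_blockDiagonal_apply` applies.
  have h2 : m ⟨i, χ⟩ = ((Matrix.of fun _ : Unit => v ᵥ* A⁻¹) * blockTableInv e) () ⟨i, χ⟩ := by
    conv_lhs => rw [h1]
    rfl
  rw [h2, blockTableInv, mul_blockDiagonal_apply]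
  refine Finset.sum_congr rfl fun c _ => ?_
  rw [mul_comm]
  congr 1
  exact Finset.sum_congr rfl fun d _ => mul_comm _ _

open Matrix in
/-- Multiplicities from the restrictions to the maximal subgroups. -/
theorem multiplicity_eq_sum_groupForm {B : Matrix (IrrLabel e) (IrrLabel e) ℂ}
    (hB : IsUnit B) (hC : charTable e = B * blockTable e) {θ : S → ℂ} {m : IrrLabel e → ℂ}
    (hθ : IsCharacter θ)
    (hm : ∀ s, θ s = ∑ ψ : IrrLabel e, m ψ * starChar ψ.2 s) (x : IrrLabel e) :
    m x = ∑ j : Fin n, ∑ ψ : Irr (MaxSubgroup (e j)),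
      B⁻¹ ⟨j, ψ⟩ x * groupForm ψ (fun g : MaxSubgroup (e j) => θ (g : S)) := by
  let v : ClassLabel e → ℂ := fun d => θ (classRep d.2 : MaxSubgroup (e d.1))
  have hv : v = m ᵥ* charTable e := funext fun d => hm _
  have h1 : m = (v ᵥ* blockTableInv e) ᵥ* B⁻¹ := by
    rw [hv, vecMul_vecMul, vecMul_vecMul, hC, Matrix.mul_assoc B, ← Matrix.mul_assoc (blockTable e),
      blockTable_mul_inv, Matrix.one_mul,
      Matrix.mul_nonsing_inv _ ((Matrix.isUnit_iff_isUnit_det _).1 hB), vecMul_one]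
  have h2 : ∀ (j : Fin n) (ψ : Irr (MaxSubgroup (e j))), (v ᵥ* blockTableInv e) ⟨j, ψ⟩ =
      groupForm ψ (fun g : MaxSubgroup (e j) => θ (g : S)) := by
    intro j ψ
    -- Being a trace, `θ` is a class function on `G_j`, so its pairing with `ψ` can be computed on
    -- class representatives.
    obtain ⟨d, ρ, hρ⟩ := hθ
    rw [groupForm_eq_sum_conjClasses ψ fun g h hgh => by rw [hρ, hρ, trace_conj_eq ρ hgh]]
    change ((Matrix.of fun _ : Unit => v) * blockTableInv e) () ⟨j, ψ⟩ = _
    rw [blockTableInv, mul_blockDiagonal_apply]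
    exact Finset.sum_congr rfl fun c _ => mul_comm _ _
  conv_lhs => rw [h1]
  rw [vecMul, dotProduct, Fintype.sum_sigma]
  refine Finset.sum_congr rfl fun j _ => Finset.sum_congr rfl fun ψ _ => ?_
  rw [h2, mul_comm]

end Tables

end InverseSemigroup

/-! ### Assembly of the theorem. -/

theorem mainTheorem8 {S : Type*} [InverseSemigroup S] [Finite S] {n : ℕ}
    (e : Fin n → Idem S) (he : IsOrderedTransversal e) :
    -- the character table is block upper triangular, with diagonal blocks the group tables
    (∀ (i j : Fin n) (χ : Irr (MaxSubgroup (e i))) (c : ConjClasses (MaxSubgroup (e j))),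
      j < i → charTable e ⟨i, χ⟩ ⟨j, c⟩ = 0) ∧
    (∀ (i : Fin n) (χ : Irr (MaxSubgroup (e i))) (c : ConjClasses (MaxSubgroup (e i))),
      charTable e ⟨i, χ⟩ ⟨i, c⟩ = groupTable (MaxSubgroup (e i)) χ c) ∧
    ∃ (A : Matrix (ClassLabel e) (ClassLabel e) ℂ) (B : Matrix (IrrLabel e) (IrrLabel e) ℂ),
      -- `A` is the unique solution of `C = Y A`
      IsBlockUpperUnitriangular A ∧ IsUnit A ∧ charTable e = blockTable e * A ∧
      (∀ A' : Matrix (ClassLabel e) (ClassLabel e) ℂ,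
        charTable e = blockTable e * A' → A' = A) ∧
      -- the entries of `A` are restriction counts
      (∀ (i j : Fin n) (h : MaxSubgroup (e i)) (g : MaxSubgroup (e j)),
        A ⟨i, ConjClasses.mk h⟩ ⟨j, ConjClasses.mk g⟩ = (restrictionCount (h : S) (g : S) : ℂ)) ∧
      -- `B` is the unique solution of `C = B Y`
      IsBlockUpperUnitriangular B ∧ IsUnit B ∧ charTable e = B * blockTable e ∧
      (∀ B' : Matrix (IrrLabel e) (IrrLabel e) ℂ,
        charTable e = B' * blockTable e → B' = B) ∧
      ∀ θ : S → ℂ, IsCharacter θ →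
        -- `θ` decomposes uniquely, and `m ψ` is the multiplicity of `ψ^*` in `θ`
        ∃ m : IrrLabel e → ℕ,
          (∀ s : S, θ s = ∑ ψ : IrrLabel e, (m ψ : ℂ) * starChar ψ.2 s) ∧
          (∀ m' : IrrLabel e → ℕ,
            (∀ s : S, θ s = ∑ ψ : IrrLabel e, (m' ψ : ℂ) * starChar ψ.2 s) → m' = m) ∧
          ∀ (i : Fin n) (χ : Irr (MaxSubgroup (e i))),
            semigroupForm χ θ = (m ⟨i, χ⟩ : ℂ) ∧
            semigroupForm χ θ =
              ∑ c : ConjClasses (MaxSubgroup (e i)),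
                χ ((classRep c)⁻¹) * (centralizerSize (classRep c) : ℂ)⁻¹ *
                  ∑ d : ClassLabel e, A⁻¹ d ⟨i, c⟩ * θ (classRep d.2 : MaxSubgroup (e d.1)) ∧
            semigroupForm χ θ =
              ∑ j : Fin n, ∑ ψ : Irr (MaxSubgroup (e j)),
                B⁻¹ ⟨j, ψ⟩ ⟨i, χ⟩ * groupForm ψ (fun g : MaxSubgroup (e j) => θ (g : S)) := by
  have hA := he.restrictionMatrix_unitriangular
  have hB := he.charTable_mul_inv_unitriangular
  have hCA := charTable_eq_mul_restrictionMatrix e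
  have hCB : charTable e = charTable e * blockTableInv e * blockTable e := by
    rw [Matrix.mul_assoc, blockTableInv_mul, Matrix.mul_one]
  refine ⟨fun i j χ c h => he.charTable_below χ c h, he.charTable_diag,
    restrictionMatrix e, charTable e * blockTableInv e, hA, hA.isUnit, hCA, ?_,
    restrictionMatrix_mk e, hB, hB.isUnit, hCB, ?_, ?_⟩
  · intro A' hA'
    rw [← Matrix.one_mul A', ← blockTableInv_mul, Matrix.mul_assoc, ← hA', hCA,
      ← Matrix.mul_assoc, blockTableInv_mul, Matrix.one_mul]
  · intro B' hB'
    rw [hB', Matrix.mul_assoc, blockTable_mul_inv, Matrix.mul_one]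
  · intro θ hθ
    obtain ⟨m, hm, hform⟩ := hθ.exists_decomposition he
    refine ⟨m, hm, fun m' hm' => funext fun ⟨i, χ⟩ => ?_, fun i χ => ⟨hform i χ, ?_, ?_⟩⟩
    · have h := multiplicity_eq_sum_restrictionMatrix hA.isUnit hCA hm i χ
      rw [← multiplicity_eq_sum_restrictionMatrix hA.isUnit hCA hm' i χ] at h
      exact_mod_cast h.symm
    · rw [hform]
      exact multiplicity_eq_sum_restrictionMatrix hA.isUnit hCA hm i χ
    · rw [hform]
      exact multiplicity_eq_sum_groupForm hB.isUnit hCB hθ hm ⟨i, χ⟩
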